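/- Let $\Omega$ be a locally compact Hausdorff space with $\dim\Omega\le\ell$ for some $\ell\in\mathbb N$, i.e. every locally finite open cover of $\Omega$ has a locally finite open refinement that covers $\Omega$ and in which every point lies in at most $\ell+1$ members. Let $\mathcal U=\{\Omega,(A_t)_{t\in\Omega},\Theta\}$ be a locally trivial continuous field of non-zero $C^*$-algebras over $\Omega$ (in the sense of Dixmier) such that every $A_t$ contains a strictly positive element, that is, a positive element at which every non-zero positive linear functional on $A_t$ is strictly positive. Let $\mathfrak A$ be the $C^*$-algebra defined by $\mathcal U$: all $x\in\Theta$ such that $\|x(t)\|$ vanishes at infinity on $\Omega$, with $\|x\|=\sup_{t}\|x(t)\|$. Then the following conditions are equivalent: (i) $\Omega$ is paracompact; (ii) $\mathfrak A$ is left projective and $\mathcal U$ is a disjoint union of $\sigma$-locally trivial continuous fields of $C^*$-algebras with strictly positive elements. Moreover, (i) or (ii) implies (iii) the second continuous Hochschild cohomology group $\mathcal H^2(\mathfrak A,X)$ vanishes for every Banach $\mathfrak A$-bimodule $X$ that is right annihilator, i.e. satisfies $X\cdot\mathfrak A=\{0\}$. Here $\mathfrak A$ is left projective if every morphism of left Banach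 $\mathfrak A$-modules $\varphi:Y\to\mathfrak A$ that has a bounded linear right inverse has a right inverse that is a morphism of left Banach $\mathfrak A$-modules. A field is trivial if it is isomorphic to a constant field. A continuous field over a space $W$ is $\sigma$-locally trivial if $W$ has an open cover $\{U_\mu\}$ such that the field induced on each $U_\mu$ is trivial, and a countable open cover $\{V_j\}$ such that each closure $\overline{V_j}$ is contained in some $U_\mu$. Finally, $\mathcal U$ is a disjoint union of fields of a given kind if $\Omega$ is the disjoint union of open subsets $W_\mu$ such that each induced field $\mathcal U|_{W_\mu}$ is of that kind. -/

import Mathlib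

open Filter Topology
open scoped ENNReal

universe u v w

/-! ### Continuous fields of C⋆-algebras -/

section Fields

/-- A continuous field of C⋆-algebras over `Ω` with fibres `A t`: an involutive subalgebra `Θ` of
the product of the fibres (the continuous vector fields) satisfying the three usual axioms. -/
structure ContinuousField (Ω : Type u) [TopologicalSpace Ω] (A : Ω → Type v)
    [∀ t, NonUnitalCStarAlgebra (A t)] where
  /-- the continuous vector fields -/
  Θ : NonUnitalStarSubalgebra ℂ (∀ t, A t)
  dense_eval : ∀ t, Dense {a : A t | ∃ x ∈ Θ, x t = a}
  continuous_norm : ∀ x ∈ Θ, Continuous fun t => ‖x t‖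
  mem_of_locally_approx : ∀ x : ∀ t, A t,
    (∀ t, ∀ ε : ℝ, 0 < ε → ∃ x' ∈ Θ, ∀ᶠ s in 𝓝 t, ‖x s - x' s‖ ≤ ε) → x ∈ Θ

namespace ContinuousField

variable {Ω : Type u} [TopologicalSpace Ω] {A : Ω → Type v} [∀ t, NonUnitalCStarAlgebra (A t)]

/-- An isomorphism of continuous fields over the same base: a family of ⋆-isomorphisms of the fibres
(automatically isometric) carrying the continuous vector fields of `U` onto those of `U'`. -/
structure Iso {A' : Ω → Type v} [∀ t, NonUnitalCStarAlgebra (A' t)]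
    (U : ContinuousField Ω A) (U' : ContinuousField Ω A') where
  /-- the isomorphisms of the fibres -/
  φ : ∀ t, A t ≃⋆ₐ[ℂ] A' t
  mem_iff : ∀ x : ∀ t, A t, x ∈ U.Θ ↔ (fun t => φ t (x t)) ∈ U'.Θ

/-- A vector field `x` over `Y ⊆ Ω` is continuous at `t₀ ∈ Y` if it can be approximated near `t₀`
(in `Y`) by continuous vector fields of `U`. -/
def IsContinuousAt (U : ContinuousField Ω A) (Y : Set Ω) (x : ∀ t : Y, A t) (t₀ : Y) : Prop :=
  ∀ ε : ℝ, 0 < ε → ∃ x' ∈ U.Θ, ∀ᶠ t : Y in 𝓝 t₀, ‖x t - x' t‖ ≤ ε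

theorem continuous_norm_of_approx {Y : Type*} [TopologicalSpace Y] {B : Y → Type*}
    [∀ t, NonUnitalCStarAlgebra (B t)] (x : ∀ t, B t)
    (h : ∀ t₀, ∀ ε : ℝ, 0 < ε → ∃ x' : ∀ t, B t, (Continuous fun t => ‖x' t‖) ∧
      ∀ᶠ t in 𝓝 t₀, ‖x t - x' t‖ ≤ ε) : Continuous fun t => ‖x t‖ := by
  rw [continuous_iff_continuousAt]
  intro t₀
  rw [Metric.continuousAt_iff']
  intro ε hε
  obtain ⟨x', hc, ha⟩ := h t₀ (ε / 4) (by positivity)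
  have h1 := (Metric.continuousAt_iff'.1 (hc.continuousAt (x := t₀))) (ε / 4) (by positivity)
  have h2 := ha.self_of_nhds
  filter_upwards [ha, h1] with t ht ht'
  rw [Real.dist_eq] at ht' ⊢
  have e1 := abs_norm_sub_norm_le (x t) (x' t)
  have e2 := abs_norm_sub_norm_le (x t₀) (x' t₀)
  rw [abs_lt] at ht' ⊢
  rw [abs_le] at e1 e2
  constructor <;> linarith [e1.1, e1.2, e2.1, e2.2, ht'.1, ht'.2]

/-- The field induced by `U` on `Y ⊆ Ω`. -/
def restrict (U : ContinuousField Ω A) (Y : Set Ω) :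
    ContinuousField Y (fun t : Y => A t) where
  Θ :=
    { carrier := {x | ∀ t₀, U.IsContinuousAt Y x t₀}
      add_mem' := by
        intro x y hx hy t₀ ε hε
        obtain ⟨x', hx', h1⟩ := hx t₀ (ε / 2) (by positivity)
        obtain ⟨y', hy', h2⟩ := hy t₀ (ε / 2) (by positivity)
        refine ⟨x' + y', add_mem hx' hy', ?_⟩
        filter_upwards [h1, h2] with t h1 h2
        calc ‖(x + y) t - (x' + y') t‖ = ‖(x t - x' t) + (y t - y' t)‖ := by
              simp only [Pi.add_apply]; congr 1; abel
          _ ≤ ε := (norm_add_le _ _).trans (by linarith)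
      zero_mem' := fun t₀ ε hε => ⟨0, zero_mem _, by simp [hε.le]⟩
      mul_mem' := by
        intro x y hx hy t₀ ε hε
        obtain ⟨y', hy', h2⟩ := hy t₀ 1 one_pos
        have hyc := (U.continuous_norm y' hy').comp (continuous_subtype_val (p := (· ∈ Y)))
        set M : ℝ := ‖y' t₀‖ + 2 with hM
        have hMpos : 0 < M := by positivity
        have hyb : ∀ᶠ t : Y in 𝓝 t₀, ‖y t‖ ≤ M := by
          have : ∀ᶠ t : Y in 𝓝 t₀, ‖y' t‖ < ‖y' t₀‖ + 1 :=
            hyc.continuousAt.eventually_lt continuousAt_const (by simp)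
          filter_upwards [h2, this] with t h2 h3
          have := norm_le_norm_add_norm_sub' (y t) (y' t)
          linarith
        obtain ⟨x₁, hx₁, h1⟩ := hx t₀ (ε / (2 * M)) (by positivity)
        have hxc := (U.continuous_norm x₁ hx₁).comp (continuous_subtype_val (p := (· ∈ Y)))
        set N : ℝ := ‖x₁ t₀‖ + 1 with hN
        have hNpos : 0 < N := by positivity
        have hxb : ∀ᶠ t : Y in 𝓝 t₀, ‖x₁ t‖ < N :=
          hxc.continuousAt.eventually_lt continuousAt_const (by simp [hN])
        obtain ⟨y₁, hy₁, h3⟩ := hy t₀ (ε / (2 * N)) (by positivity)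
        refine ⟨x₁ * y₁, mul_mem hx₁ hy₁, ?_⟩
        filter_upwards [h1, h3, hyb, hxb] with t h1 h3 hyb hxb
        have e : (x * y) t - (x₁ * y₁) t = (x t - x₁ t) * y t + x₁ t * (y t - y₁ t) := by
          simp only [Pi.mul_apply, sub_mul, mul_sub]; abel
        rw [e]
        calc _ ≤ ‖x t - x₁ t‖ * ‖y t‖ + ‖x₁ t‖ * ‖y t - y₁ t‖ :=
              (norm_add_le _ _).trans (add_le_add (norm_mul_le _ _) (norm_mul_le _ _))
          _ ≤ ε / (2 * M) * M + N * (ε / (2 * N)) := by gcongr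
          _ = ε := by field_simp; norm_num
      smul_mem' := by
        intro c x hx t₀ ε hε
        obtain ⟨x', hx', h1⟩ := hx t₀ (ε / (‖c‖ + 1)) (by positivity)
        refine ⟨c • x', SMulMemClass.smul_mem c hx', ?_⟩
        filter_upwards [h1] with t h1
        rw [Pi.smul_apply, Pi.smul_apply, ← smul_sub, norm_smul]
        calc _ ≤ (‖c‖ + 1) * (ε / (‖c‖ + 1)) := by gcongr; linarith
          _ = ε := by field_simp
      star_mem' := by
        intro x hx t₀ ε hε
        obtain ⟨x', hx', h1⟩ := hx t₀ ε hε
        refine ⟨star x', star_mem hx', ?_⟩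
        filter_upwards [h1] with t h1
        rwa [Pi.star_apply, Pi.star_apply, ← star_sub, norm_star] }
  dense_eval := by
    intro t
    refine (U.dense_eval t).mono ?_
    rintro a ⟨x, hx, rfl⟩
    exact ⟨fun s => x s, fun t₀ ε hε => ⟨x, hx, by simp [hε.le]⟩, rfl⟩
  continuous_norm := by
    intro x hx
    refine continuous_norm_of_approx x fun t₀ ε hε => ?_
    obtain ⟨x', hx', h⟩ := hx t₀ ε hε
    exact ⟨fun t => x' t, (U.continuous_norm x' hx').comp continuous_subtype_val, h⟩
  mem_of_locally_approx := by
    intro x hx t₀ ε hε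
    obtain ⟨x', hx', h⟩ := hx t₀ (ε / 2) (by positivity)
    obtain ⟨x'', hx'', h'⟩ := hx' t₀ (ε / 2) (by positivity)
    refine ⟨x'', hx'', ?_⟩
    filter_upwards [h, h'] with t h h'
    have := norm_sub_le_norm_sub_add_norm_sub (x t) (x' t) (x'' t)
    linarith

/-- The constant field over `Ω` defined by `B`. -/
def const (Ω : Type u) [TopologicalSpace Ω] (B : Type v) [NonUnitalCStarAlgebra B] :
    ContinuousField Ω (fun _ : Ω => B) where
  Θ :=
    { carrier := {x | Continuous x}
      add_mem' := fun hx hy => Continuous.add hx hy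
      zero_mem' := continuous_const
      mul_mem' := fun hx hy => Continuous.mul hx hy
      smul_mem' := fun c _ hx => Continuous.const_smul hx c
      star_mem' := fun hx => Continuous.star hx }
  dense_eval := by
    intro t
    convert dense_univ
    ext a
    simp only [Set.mem_ofPred_eq, Set.mem_univ, iff_true]
    exact ⟨fun _ => a, continuous_const, rfl⟩
  continuous_norm := fun _ hx => Continuous.norm hx
  mem_of_locally_approx := by
    intro x hx
    refine continuous_iff_continuousAt.2 fun t₀ => Metric.continuousAt_iff'.2 fun ε hε => ?_
    obtain ⟨x', hx', h⟩ := hx t₀ (ε / 4) (by positivity)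
    have h1 := (Metric.continuousAt_iff'.1 (Continuous.continuousAt (x := t₀) hx')) (ε / 4) (by positivity)
    have h2 := h.self_of_nhds
    filter_upwards [h, h1] with t ht ht'
    rw [← dist_eq_norm] at ht h2
    have e1 := dist_triangle4 (x t) (x' t) (x' t₀) (x t₀)
    rw [dist_comm (x' t₀)] at e1
    linarith

/-- A field is trivial if it is isomorphic to a constant field. -/
def IsTrivial (U : ContinuousField Ω A) : Prop :=
  ∃ (B : Type v) (_ : NonUnitalCStarAlgebra B), Nonempty (Iso U (const Ω B))

/-- A field is locally trivial if every point has an open neighbourhood on which the induced field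
is trivial. -/
def IsLocallyTrivial (U : ContinuousField Ω A) : Prop :=
  ∀ t : Ω, ∃ V : Set Ω, IsOpen V ∧ t ∈ V ∧ (U.restrict V).IsTrivial

/-- A field is σ-locally trivial if its base has an open cover `W` such that all the induced fields
over the members of `W` are trivial, and a countable open cover `V` such that the closure of each
member of `V` lies in some member of `W`. -/
def IsSigmaLocallyTrivial (U : ContinuousField Ω A) : Prop :=
  ∃ (M : Type u) (W : M → Set Ω),
    (∀ μ, IsOpen (W μ)) ∧ (⋃ μ, W μ) = Set.univ ∧ (∀ μ, (U.restrict (W μ)).IsTrivial) ∧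
    ∃ (J : Type) (_ : Countable J) (V : J → Set Ω),
      (∀ j, IsOpen (V j)) ∧ (⋃ j, V j) = Set.univ ∧ ∀ j, ∃ μ, closure (V j) ⊆ W μ

end ContinuousField

/-- An element of a C⋆-algebra is strictly positive if it is positive and every nonzero positive
linear functional takes a strictly positive value at it. -/
def IsStrictlyPositiveElement {B : Type v} [NonUnitalCStarAlgebra B] (h : B) : Prop :=
  (∃ b : B, h = star b * b) ∧
    ∀ f : B →L[ℂ] ℂ, (∀ b : B, 0 ≤ (f (star b * b)).re ∧ (f (star b * b)).im = 0) → f ≠ 0 →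
      0 < (f h).re

namespace ContinuousField

variable {Ω : Type u} [TopologicalSpace Ω] {A : Ω → Type v} [∀ t, NonUnitalCStarAlgebra (A t)]

/-- All fibres of the field contain a strictly positive element. -/
def HasStrictlyPositiveElements (_U : ContinuousField Ω A) : Prop :=
  ∀ t, ∃ h : A t, IsStrictlyPositiveElement h

/-- `U` is a disjoint union of σ-locally trivial fields of C⋆-algebras with strictly positive
elements, namely of the fields that it induces on the members of a partition into open sets. -/
def IsDisjointUnionOfSigmaLocallyTrivial (U : ContinuousField Ω A) : Prop :=
  ∃ (M : Type u) (W : M → Set Ω),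
    (∀ μ, IsOpen (W μ)) ∧ (Pairwise fun μ ν => Disjoint (W μ) (W ν)) ∧ (⋃ μ, W μ) = Set.univ ∧
    ∀ μ, (U.restrict (W μ)).IsSigmaLocallyTrivial ∧ (U.restrict (W μ)).HasStrictlyPositiveElements

/-- The C⋆-algebra defined by `U`: the continuous vector fields whose norm vanishes at infinity, with
the supremum norm, realised inside the C⋆-algebra of all bounded vector fields. -/
noncomputable def sectionAlgebra (U : ContinuousField Ω A) : NonUnitalStarSubalgebra ℂ (lp A ∞) where
  carrier := {x | (fun t => x t) ∈ U.Θ ∧ Tendsto (fun t => ‖x t‖) (cocompact Ω) (𝓝 0)}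
  add_mem' := by
    rintro x y ⟨hx, hx'⟩ ⟨hy, hy'⟩
    refine ⟨add_mem hx hy, ?_⟩
    refine squeeze_zero (fun _ => norm_nonneg _) (fun t => norm_add_le (x t) (y t)) ?_
    simpa using hx'.add hy'
  zero_mem' := ⟨zero_mem U.Θ, by simpa using tendsto_const_nhds⟩
  mul_mem' := by
    rintro x y ⟨hx, hx'⟩ ⟨hy, hy'⟩
    refine ⟨mul_mem hx hy, ?_⟩
    refine squeeze_zero (fun _ => norm_nonneg _) (fun t => norm_mul_le (x t) (y t)) ?_
    simpa using hx'.mul hy'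
  smul_mem' := by
    rintro c x ⟨hx, hx'⟩
    refine ⟨SMulMemClass.smul_mem c hx, ?_⟩
    have : (fun t => ‖(c • x : lp A ∞) t‖) = fun t => ‖c‖ * ‖x t‖ := by
      funext t; rw [lp.coeFn_smul, Pi.smul_apply, norm_smul]
    rw [this]
    simpa using hx'.const_mul ‖c‖
  star_mem' := by
    rintro x ⟨hx, hx'⟩
    refine ⟨star_mem hx, ?_⟩
    have : (fun t => ‖(star x : lp A ∞) t‖) = fun t => ‖x t‖ := by
      funext t; rw [lp.coeFn_star, Pi.star_apply, norm_star]
    rw [this]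
    exact hx'

instance isClosed_sectionAlgebra (U : ContinuousField Ω A) :
    IsClosed (U.sectionAlgebra : Set (lp A ∞)) := by
  refine isClosed_of_closure_subset fun x hx => ?_
  rw [Metric.mem_closure_iff] at hx
  have key : ∀ ε : ℝ, 0 < ε → ∃ y : lp A ∞, y ∈ U.sectionAlgebra ∧ ∀ t, ‖x t - y t‖ ≤ ε := by
    intro ε hε
    obtain ⟨y, hy, hxy⟩ := hx ε hε
    refine ⟨y, hy, fun t => ?_⟩
    rw [dist_eq_norm] at hxy
    exact (lp.norm_apply_le_norm ENNReal.top_ne_zero (x - y) t).trans hxy.le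
  refine ⟨U.mem_of_locally_approx _ fun t ε hε => ?_, ?_⟩
  · obtain ⟨y, hy, h⟩ := key ε hε
    exact ⟨_, hy.1, Eventually.of_forall h⟩
  · rw [Metric.tendsto_nhds]
    intro ε hε
    obtain ⟨y, hy, h⟩ := key (ε / 2) (by positivity)
    have h1 := (Metric.tendsto_nhds.1 hy.2) (ε / 2) (by positivity)
    filter_upwards [h1] with t ht
    rw [dist_zero_right, norm_norm] at ht ⊢
    have := norm_le_norm_add_norm_sub' (x t) (y t)
    have := h t
    linarith

/-- Boundedness is no restriction: every continuous vector field whose norm vanishes at infinity is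
an element of the section algebra. -/
theorem exists_mem_sectionAlgebra (U : ContinuousField Ω A) (x : ∀ t, A t) (hx : x ∈ U.Θ)
    (h : Tendsto (fun t => ‖x t‖) (cocompact Ω) (𝓝 0)) :
    ∃ y ∈ U.sectionAlgebra, ∀ t, y t = x t := by
  have hc := U.continuous_norm x hx
  have hev : ∀ᶠ t in cocompact Ω, ‖x t‖ < 1 := h.eventually_lt_const one_pos
  obtain ⟨K, hK, hKs⟩ := mem_cocompact.1 hev
  obtain ⟨C, hC⟩ := hK.bddAbove_image hc.continuousOn
  have hb : Memℓp x ∞ := by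
    refine memℓp_infty ⟨max C 1, ?_⟩
    rintro _ ⟨t, rfl⟩
    by_cases ht : t ∈ K
    · exact (hC ⟨t, ht, rfl⟩).trans (le_max_left _ _)
    · exact (le_of_lt (hKs ht)).trans (le_max_right _ _)
  exact ⟨⟨x, hb⟩, ⟨hx, h⟩, fun _ => rfl⟩

end ContinuousField

end Fields

/-! ### Topological dimension -/

/-- `dim Ω ≤ n`: every locally finite open cover of `Ω` has a locally finite open refinement that
covers `Ω` and of which no more than `n + 1` members have a common point. -/
def TopologicalDimLE (Ω : Type u) [TopologicalSpace Ω] (n : ℕ) : Prop :=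
  ∀ (ι : Type u) (U : ι → Set Ω), (∀ i, IsOpen (U i)) → LocallyFinite U → (⋃ i, U i) = Set.univ →
    ∃ (κ : Type u) (V : κ → Set Ω), (∀ j, IsOpen (V j)) ∧ LocallyFinite V ∧
      (⋃ j, V j) = Set.univ ∧ (∀ j, ∃ i, V j ⊆ U i) ∧ ∀ t, {j | t ∈ V j}.encard ≤ n + 1

/-! ### Banach modules, projectivity, continuous Hochschild cohomology -/

section Modules

/-- A left Banach module structure on the Banach space `Y`: a bounded bilinear associative action. -/
structure LeftBanachModule (B : Type v) [NonUnitalNormedRing B] [NormedSpace ℂ B]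
    (Y : Type w) [NormedAddCommGroup Y] [NormedSpace ℂ Y] where
  /-- the left action -/
  act : B →L[ℂ] Y →L[ℂ] Y
  act_mul : ∀ a b y, act (a * b) y = act a (act b y)

/-- A Banach bimodule structure on the Banach space `X`; `ract a x` stands for `x · a`. -/
structure BanachBimodule (B : Type v) [NonUnitalNormedRing B] [NormedSpace ℂ B]
    (X : Type w) [NormedAddCommGroup X] [NormedSpace ℂ X] extends LeftBanachModule B X where
  /-- the right action -/
  ract : B →L[ℂ] X →L[ℂ] X
  ract_mul : ∀ a b x, ract (a * b) x = ract b (ract a x)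
  ract_act : ∀ a b x, ract b (act a x) = act a (ract b x)

/-- A Banach algebra `B` is left projective: every morphism of left Banach modules onto `B` that has
a bounded linear right inverse has a right inverse that is a morphism of left Banach modules. The
modules are taken from a universe at least as large as that of `B`. -/
def IsLeftProjective (B : Type v) [NonUnitalNormedRing B] [NormedSpace ℂ B] : Prop :=
  ∀ (Y : Type (max v w)) [NormedAddCommGroup Y] [NormedSpace ℂ Y] [CompleteSpace Y]
    (m : LeftBanachModule B Y) (φ : Y →L[ℂ] B), (∀ a y, φ (m.act a y) = a * φ y) →
    (∃ σ : B →L[ℂ] Y, ∀ b, φ (σ b) = b) →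
    ∃ ψ : B →L[ℂ] Y, (∀ a b, ψ (a * b) = m.act a (ψ b)) ∧ ∀ b, φ (ψ b) = b

namespace BanachBimodule

variable {B : Type v} [NonUnitalNormedRing B] [NormedSpace ℂ B]
  {X : Type w} [NormedAddCommGroup X] [NormedSpace ℂ X]

/-- A bimodule is right annihilator if `X · B = 0`. -/
def IsRightAnnihilator (m : BanachBimodule B X) : Prop :=
  ∀ a x, m.ract a x = 0

/-- The space of `n`-cochains: bounded `n`-linear maps from `B` to `X`. -/
abbrev Cochain (_m : BanachBimodule B X) (n : ℕ) : Type (max v w) :=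
  ContinuousMultilinearMap ℂ (fun _ : Fin n => B) X

/-- The Hochschild coboundary of `f`, as a function of `n + 1` variables:
`a₁ · f(a₂,…) + ∑ (-1)ⁱ f(…,aᵢaᵢ₊₁,…) + (-1)ⁿ⁺¹ f(a₁,…,aₙ) · aₙ₊₁`. -/
noncomputable def coboundary (m : BanachBimodule B X) (n : ℕ) :
    m.Cochain n →ₗ[ℂ] ((Fin (n + 1) → B) → X) where
  toFun f a := m.act (a 0) (f (Fin.tail a)) +
    ∑ i : Fin n, (-1 : ℂ) ^ ((i : ℕ) + 1) • f (Fin.contractNth i.castSucc (· * ·) a) +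
    (-1 : ℂ) ^ (n + 1) • m.ract (a (Fin.last n)) (f (Fin.init a))
  map_add' f g := by
    funext a
    simp only [add_apply, map_add, smul_add, Finset.sum_add_distrib,
      Pi.add_apply]
    abel
  map_smul' c f := by
    funext a
    simp only [smul_apply, map_smul, Pi.smul_apply, RingHom.id_apply,
      smul_add, Finset.smul_sum]
    simp only [smul_comm c]

/-- The space of `n`-cocycles. -/
noncomputable def cocycles (m : BanachBimodule B X) (n : ℕ) : Submodule ℂ (m.Cochain n) :=
  LinearMap.ker (m.coboundary n)

/-- The cochains of degree `n + 1` that are the coboundary of an `n`-cochain. -/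
noncomputable def coboundariesSucc (m : BanachBimodule B X) (n : ℕ) :
    Submodule ℂ (m.Cochain (n + 1)) where
  carrier := {g | ∃ f : m.Cochain n, m.coboundary n f = g}
  add_mem' := by
    rintro g g' ⟨f, hf⟩ ⟨f', hf'⟩
    exact ⟨f + f', by rw [map_add, hf, hf']; rfl⟩
  zero_mem' := ⟨0, by rw [map_zero]; rfl⟩
  smul_mem' := by
    rintro c g ⟨f, hf⟩
    exact ⟨c • f, by rw [map_smul, hf]; rfl⟩

/-- The space of `n`-coboundaries. -/
noncomputable def coboundaries (m : BanachBimodule B X) : ∀ n : ℕ, Submodule ℂ (m.Cochain n)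
  | 0 => ⊥
  | n + 1 => m.coboundariesSucc n

/-- The `n`-th continuous Hochschild cohomology group: cocycles modulo coboundaries. -/
abbrev Cohomology (m : BanachBimodule B X) (n : ℕ) : Type (max v w) :=
  m.cocycles n ⧸ (m.coboundaries n).submoduleOf (m.cocycles n)

end BanachBimodule

end Modules

/-! ### Splitting off a module morphism from an orthogonal-type family -/

section Modules

/-! Both conditions amount to a partition of `Ω` into open σ-compact sets, which for a locally
compact Hausdorff space is paracompactness.

From (i) to (ii): over each piece, a weighted sum of countably many local sections gives a section
`h μ` that is strictly positive in every fibre over the piece. Functional calculus with bump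
functions whose squares telescope produces elements `u (μ, n)`: only neighbours have nonzero
product, signed finite sums are bounded by 2, and `∑ b * u i * u i = b`. The last point holds
because the ramps of a strictly positive element form an approximate unit; otherwise a weak-* limit
of positive functionals would be nonzero and kill the element. If `σ` is a bounded linear right
inverse of `φ`, then `ψ b = ∑ (b * u i) · σ (u i)` is a module splitting; averaging over signs
bounds its partial sums (`isLeftProjective_of_family`, `isLeftProjective_of_partition`).

From (ii) to (i): over a trivialising set `V`, kernels `F s t` that restrict to a section on the
diagonal and vanish at infinity in `t` form a left module in the variable `s`. Splitting its
projection onto the section algebra and cutting off a constant `b` gives a continuous map `k` from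
`V` to bounded functions, with `k s s = star b * b` fixed and `k s` vanishing at infinity. The range
of `k` is metric, hence paracompact, and pulling back a locally finite cover by small sets covers
`V` by relatively compact open sets, locally finitely (`exists_locallyFinite_cover`). σ-local
triviality combines these covers into one of `Ω` in which each member meets countably many others;
its chain components are the desired pieces.

For (iii), a 2-cocycle twists the action on `X × B`; a splitting of the projection onto `B` yields
the cochain that it bounds. -/

theorem norm_add_signed_sum_le {ι H : Type*} [DecidableEq ι] [NormedAddCommGroup H]
    [NormedSpace ℂ H] {s : Finset ι} {j : ι} (hj : j ∉ s) (z : ι → H) (z₀ : H) (K : ℝ)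
    (h : ∀ ε : ι → ℤˣ, ‖z₀ + ∑ i ∈ insert j s, ((ε i : ℤ) : ℂ) • z i‖ ≤ K) (η : ℤˣ)
    (ε : ι → ℤˣ) : ‖(z₀ + ((η : ℤ) : ℂ) • z j) + ∑ i ∈ s, ((ε i : ℤ) : ℂ) • z i‖ ≤ K := by
  have := h (Function.update ε j η)
  rw [Finset.sum_insert hj, ← add_assoc, Function.update_self] at this
  refine le_of_eq_of_le ?_ this
  congr 2
  refine Finset.sum_congr rfl fun i hi => ?_
  rw [Function.update_of_ne (by rintro rfl; exact hj hi)]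

/-- The sum of a bounded bilinear map over a finite family is controlled by signed sums. -/
theorem norm_bilin_add_sum_le {ι E F G : Type*} [NormedAddCommGroup E] [NormedSpace ℂ E]
    [NormedAddCommGroup F] [NormedSpace ℂ F] [NormedAddCommGroup G] [NormedSpace ℂ G]
    (β : E →L[ℂ] F →L[ℂ] G) (x : ι → E) (y : ι → F) (C D : ℝ) (s : Finset ι) :
    ∀ (x₀ : E) (y₀ : F),
      (∀ ε : ι → ℤˣ, ‖x₀ + ∑ i ∈ s, ((ε i : ℤ) : ℂ) • x i‖ ≤ C) →
      (∀ ε : ι → ℤˣ, ‖y₀ + ∑ i ∈ s, ((ε i : ℤ) : ℂ) • y i‖ ≤ D) →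
      ‖β x₀ y₀ + ∑ i ∈ s, β (x i) (y i)‖ ≤ ‖β‖ * C * D := by
  classical
  induction s using Finset.induction_on with
  | empty =>
    intro x₀ y₀ hx hy
    have hx := hx 1
    have hy := hy 1
    simp only [Finset.sum_empty, add_zero] at hx hy ⊢
    refine (β.le_opNorm₂ x₀ y₀).trans ?_
    have := (norm_nonneg x₀).trans hx
    gcongr
  | insert j s hj ih =>
    intro x₀ y₀ hx hy
    have h1 := ih _ _ (norm_add_signed_sum_le hj x x₀ C hx 1)
      (norm_add_signed_sum_le hj y y₀ D hy 1)
    have h2 := ih _ _ (norm_add_signed_sum_le hj x x₀ C hx (-1))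
      (norm_add_signed_sum_le hj y y₀ D hy (-1))
    -- Averaging over the sign of the term `j` cancels the cross terms: `β x₀ y₀ + β (x j) (y j)` is
    -- the mean of `β (x₀ ± x j) (y₀ ± y j)`.
    have e : β x₀ y₀ + ∑ i ∈ insert j s, β (x i) (y i) = (2⁻¹ : ℂ) •
        ((β (x₀ + (((1 : ℤˣ) : ℤ) : ℂ) • x j) (y₀ + (((1 : ℤˣ) : ℤ) : ℂ) • y j)
          + ∑ i ∈ s, β (x i) (y i)) +
        (β (x₀ + (((-1 : ℤˣ) : ℤ) : ℂ) • x j) (y₀ + (((-1 : ℤˣ) : ℤ) : ℂ) • y j)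
          + ∑ i ∈ s, β (x i) (y i))) := by
      rw [Finset.sum_insert hj]
      simp only [Units.val_one, Int.cast_one, one_smul, Units.val_neg, Int.cast_neg, neg_smul,
        map_add, map_neg, add_apply, neg_apply]
      module
    rw [e, norm_smul]
    have := norm_add_le
      (β (x₀ + (((1 : ℤˣ) : ℤ) : ℂ) • x j) (y₀ + (((1 : ℤˣ) : ℤ) : ℂ) • y j)
          + ∑ i ∈ s, β (x i) (y i))
        (β (x₀ + (((-1 : ℤˣ) : ℤ) : ℂ) • x j) (y₀ + (((-1 : ℤˣ) : ℤ) : ℂ) • y j)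
          + ∑ i ∈ s, β (x i) (y i))
    have h3 : ‖(2⁻¹ : ℂ)‖ = 2⁻¹ := by simp
    rw [h3]
    linarith

/-- A Banach algebra with an almost orthogonal family `u` such that `∑ b uᵢ² = b` for all `b` is
left projective. -/
theorem isLeftProjective_of_family {B : Type v} [NonUnitalNormedRing B] [NormedSpace ℂ B]
    [IsScalarTower ℂ B B] [SMulCommClass ℂ B B] {ι : Type*} (u : ι → B) (C : ℝ)
    (hC : ∀ (s : Finset ι) (ε : ι → ℤˣ), ‖∑ i ∈ s, ((ε i : ℤ) : ℂ) • u i‖ ≤ C)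
    (hfin : ∀ i, {j | u i * u j ≠ 0}.Finite)
    (hsum : ∀ b, HasSum (fun i => b * u i * u i) b) : IsLeftProjective.{v, w} B := by
  classical
  intro Y _ _ _ m φ hφ ⟨σ, hσ⟩
  set β : B →L[ℂ] B →L[ℂ] Y := m.act.bilinearComp (ContinuousLinearMap.id ℂ B) σ with hβ
  have hβa : ∀ a b, β a b = m.act a (σ b) := fun a b => rfl
  have hC0 : 0 ≤ C := (norm_nonneg _).trans (hC ∅ 1)
  have bound : ∀ b (s : Finset ι), ‖∑ i ∈ s, β (b * u i) (u i)‖ ≤ ‖β‖ * C * C * ‖b‖ := by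
    intro b s
    have := norm_bilin_add_sum_le β (fun i => b * u i) u (‖b‖ * C) C s 0 0 (fun ε => ?_)
      (fun ε => by simpa using hC s ε)
    · simp only [map_zero, zero_add] at this
      linarith
    · rw [zero_add]
      simp_rw [← mul_smul_comm]
      rw [← Finset.mul_sum]
      exact (norm_mul_le _ _).trans (by gcongr; exact hC s ε)
  have hsummable : ∀ b, Summable fun i => β (b * u i) (u i) := by
    intro b
    rw [summable_iff_vanishing_norm]
    intro δ hδ
    -- Cauchy criterion: a partial sum `e` close to `b` is annihilated by `u i` for all but finitely
    -- many `i`, so far out the series of `b` is that of `b - e`, controlled by `bound`. The `+ 1`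
    -- keeps the denominator positive.
    obtain ⟨G, hG⟩ := ((Metric.tendsto_nhds.1 (hsum b)) (δ / (‖β‖ * C * C + 1))
      (by positivity)).exists
    refine ⟨G.biUnion fun j => (hfin j).toFinset, fun t ht => ?_⟩
    set e := ∑ i ∈ G, b * u i * u i with he
    have hz : ∑ i ∈ t, β (e * u i) (u i) = 0 := by
      refine Finset.sum_eq_zero fun i hi => ?_
      have : e * u i = 0 := by
        rw [he, Finset.sum_mul]
        refine Finset.sum_eq_zero fun j hj => ?_
        have : u j * u i = 0 := by
          by_contra hne
          exact (Finset.disjoint_left.1 ht hi) (Finset.mem_biUnion.2 ⟨j, hj, by simpa using hne⟩)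
        rw [mul_assoc, this, mul_zero]
      rw [this, map_zero, zero_apply]
    have hb : ∑ i ∈ t, β (b * u i) (u i) = ∑ i ∈ t, β ((b - e) * u i) (u i) := by
      simp only [sub_mul, map_sub, sub_apply, Finset.sum_sub_distrib, hz, sub_zero]
    rw [hb]
    refine (bound _ _).trans_lt ?_
    rw [dist_comm, dist_eq_norm] at hG
    calc ‖β‖ * C * C * ‖b - e‖ ≤ (‖β‖ * C * C + 1) * ‖b - e‖ := by gcongr; linarith
      _ < (‖β‖ * C * C + 1) * (δ / (‖β‖ * C * C + 1)) := by gcongr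
      _ = δ := by field_simp
  let ψ₀ : B →ₗ[ℂ] Y :=
    { toFun := fun b => ∑' i, β (b * u i) (u i)
      map_add' := fun a b => by
        simp only [add_mul, map_add, add_apply]
        exact (hsummable a).tsum_add (hsummable b)
      map_smul' := fun c b => by
        simp only [smul_mul_assoc, map_smul, smul_apply, RingHom.id_apply]
        exact (hsummable b).tsum_const_smul c }
  have hψ₀ : ∀ b, ψ₀ b = ∑' i, β (b * u i) (u i) := fun b => rfl
  refine ⟨ψ₀.mkContinuous (‖β‖ * C * C) fun b => ?_, fun a b => ?_, fun b => ?_⟩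
  · exact le_of_tendsto (hsummable b).hasSum.norm (Eventually.of_forall (bound b))
  · simp only [LinearMap.mkContinuous_apply, hψ₀]
    rw [(m.act a).map_tsum (hsummable b)]
    exact tsum_congr fun i => by rw [hβa, hβa, mul_assoc, m.act_mul]
  · simp only [LinearMap.mkContinuous_apply, hψ₀]
    rw [φ.map_tsum (hsummable b)]
    refine Eq.trans (tsum_congr fun i => ?_) (hsum b).tsum_eq
    rw [hβa, hφ, hσ]

/-- Left projectivity allows to split modules from the universe of the algebra itself. -/
theorem IsLeftProjective.exists_splitting {B : Type v} [NonUnitalNormedRing B] [NormedSpace ℂ B]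
    (h : IsLeftProjective.{v, w} B) {Y : Type v} [NormedAddCommGroup Y] [NormedSpace ℂ Y]
    [CompleteSpace Y] (m : LeftBanachModule B Y) (φ : Y →L[ℂ] B)
    (hφ : ∀ a y, φ (m.act a y) = a * φ y) (σ : B →L[ℂ] Y) (hσ : ∀ b, φ (σ b) = b) :
    ∃ ψ : B →L[ℂ] Y, (∀ a b, ψ (a * b) = m.act a (ψ b)) ∧ ∀ b, φ (ψ b) = b := by
  let up : Y →L[ℂ] ULift.{w} Y := ContinuousLinearEquiv.ulift.symm.toContinuousLinearMap
  let down : ULift.{w} Y →L[ℂ] Y := ContinuousLinearEquiv.ulift.toContinuousLinearMap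
  have hdu : ∀ y, down (up y) = y := fun y => rfl
  let m' : LeftBanachModule B (ULift.{w} Y) :=
    { act := (ContinuousLinearMap.compL ℂ (ULift.{w} Y) Y (ULift.{w} Y) up).comp
        (((ContinuousLinearMap.compL ℂ (ULift.{w} Y) Y Y).flip down).comp m.act)
      act_mul := fun a b y => by
        change up (m.act (a * b) (down y)) = up (m.act a (down (up (m.act b (down y)))))
        rw [hdu, m.act_mul] }
  have hm' : ∀ a y, m'.act a y = up (m.act a (down y)) := fun a y => rfl
  obtain ⟨ψ, h1, h2⟩ := h (ULift.{w} Y) m' (φ.comp down)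
    (fun a y => by
      change φ (down (up (m.act a (down y)))) = a * φ (down y)
      rw [hdu, hφ])
    ⟨up.comp σ, fun b => hσ b⟩
  refine ⟨down.comp ψ, fun a b => ?_, h2⟩
  change down (ψ (a * b)) = m.act a (down (ψ b))
  rw [h1, hm', hdu]

/-- The second cohomology of a left projective algebra with coefficients in a right annihilator
bimodule vanishes. -/
theorem IsLeftProjective.subsingleton_cohomology_two {B : Type v} [NonUnitalNormedRing B]
    [NormedSpace ℂ B] [IsScalarTower ℂ B B] [SMulCommClass ℂ B B] [CompleteSpace B]
    (h : IsLeftProjective.{v, w} B) (X : Type (max v w))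
    [NormedAddCommGroup X] [NormedSpace ℂ X] [CompleteSpace X] (m : BanachBimodule B X)
    (hm : m.IsRightAnnihilator) : Subsingleton (m.Cohomology 2) := by
  rw [Submodule.Quotient.subsingleton_iff, Submodule.submoduleOf_eq_top]
  intro f hf
  let f₂ : B →L[ℂ] B →L[ℂ] X :=
    (continuousMultilinearCurryFin1 ℂ B X).toContinuousLinearEquiv.toContinuousLinearMap.comp
      (continuousMultilinearCurryLeftEquiv ℂ (fun _ : Fin 2 => B) X f)
  have hf₂ : ∀ a : Fin 2 → B, f a = f₂ (a 0) (a 1) := by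
    intro a
    change f a = f (Fin.cons (a 0) (Fin.snoc 0 (a 1)))
    congr 1
    ext i
    fin_cases i <;> rfl
  have hcoc : ∀ a b c, m.act a (f₂ b c) - f₂ (a * b) c + f₂ a (b * c) = 0 := by
    intro a b c
    have := congrFun (LinearMap.mem_ker.1 hf) ![a, b, c]
    simp only [BanachBimodule.coboundary, LinearMap.coe_mk, AddHom.coe_mk, hm _ _, smul_zero,
      add_zero, Fin.sum_univ_two, hf₂] at this
    simpa [Fin.tail, Fin.contractNth, sub_eq_add_neg, add_assoc] using this
  -- The action on `X × B` twisted by the cocycle. As the right action is zero, its associativity is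
  -- exactly the cocycle identity `hcoc`.
  let μ : B →ₗ[ℂ] (X × B) →ₗ[ℂ] X × B := LinearMap.mk₂ ℂ
    (fun a y => (m.act a y.1 + f₂ a y.2, a * y.2))
    (fun a a' y => by ext <;> simp [add_mul]; abel)
    (fun c a y => by ext <;> simp [smul_mul_assoc])
    (fun a y y' => by ext <;> simp [mul_add]; abel)
    (fun c a y => by ext <;> simp [mul_smul_comm])
  have hμ : ∀ a y, μ a y = (m.act a y.1 + f₂ a y.2, a * y.2) := fun a y => rfl
  let mY : LeftBanachModule B (X × B) :=
    { act := μ.mkContinuous₂ (‖m.act‖ + ‖f₂‖ + 1) (fun a y => by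
        have h1 := m.act.le_opNorm₂ a y.1
        have h2 := f₂.le_opNorm₂ a y.2
        have h3 := norm_mul_le a y.2
        have h4 := norm_fst_le y
        have h5 := norm_snd_le y
        have h6 : ‖m.act‖ * ‖a‖ * ‖y.1‖ ≤ ‖m.act‖ * ‖a‖ * ‖y‖ := by gcongr
        have h7 : ‖f₂‖ * ‖a‖ * ‖y.2‖ ≤ ‖f₂‖ * ‖a‖ * ‖y‖ := by gcongr
        have h8 : ‖a‖ * ‖y.2‖ ≤ ‖a‖ * ‖y‖ := by gcongr
        have h9 : 0 ≤ ‖a‖ * ‖y‖ := by positivity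
        have h10 : 0 ≤ ‖m.act‖ * ‖a‖ * ‖y‖ := by positivity
        have h11 : 0 ≤ ‖f₂‖ * ‖a‖ * ‖y‖ := by positivity
        rw [hμ, Prod.norm_def]
        refine max_le ((norm_add_le _ _).trans ?_) ?_ <;> linarith)
      act_mul := fun a b y => by
        change μ (a * b) y = μ a (μ b y)
        have := hcoc a b y.2
        simp only [hμ, m.act_mul, map_add, mul_assoc, Prod.mk.injEq, and_true]
        rw [add_assoc, add_right_inj, ← sub_eq_zero, ← neg_eq_zero, ← this]
        abel }
  have hmY : ∀ a y, mY.act a y = (m.act a y.1 + f₂ a y.2, a * y.2) := fun a y => rfl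
  obtain ⟨ψ, h1, h2⟩ := h (X × B) mY (ContinuousLinearMap.snd ℂ X B)
    (fun a y => rfl) ⟨ContinuousLinearMap.inr ℂ X B, fun b => rfl⟩
  -- With `ξ` the first component of `ψ`, the morphism property reads `ξ (a * b) = a · ξ b + f (a,
  -- b)`, so `f` is the coboundary of `-ξ`.
  refine ⟨(continuousMultilinearCurryFin1 ℂ B X).symm
    (-(ContinuousLinearMap.fst ℂ X B).comp ψ), ?_⟩
  funext a
  have h3 := congrArg Prod.fst (h1 (a 0) (a 1))
  rw [hmY] at h3
  have h4 : (ψ (a 1)).2 = a 1 := h2 (a 1)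
  rw [h4] at h3
  rw [hf₂ a]
  simp only [BanachBimodule.coboundary, LinearMap.coe_mk, AddHom.coe_mk, hm _ _, smul_zero,
      add_zero, Finset.univ_unique, Finset.sum_singleton]
  simp [Fin.tail, Fin.contractNth, h3]

end Modules

/-! ### Locally compact spaces with a partition into σ-compact open sets -/

section Topology

/-- The points reached in exactly `n` steps form a countable set, by induction on `n`. -/
theorem countable_reflTransGen {ι : Type*} (r : ι → ι → Prop) (hr : ∀ i, {j | r i j}.Countable)
    (i : ι) : {j | Relation.ReflTransGen r i j}.Countable := by
  let S : ℕ → Set ι := fun n => Nat.rec {i} (fun _ T => ⋃ k ∈ T, {j | r k j}) n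
  have hS : ∀ n, (S n).Countable := by
    intro n
    induction n with
    | zero => exact Set.countable_singleton i
    | succ n ih => exact ih.biUnion fun k _ => hr k
  refine (Set.countable_iUnion hS).mono ?_
  intro j hj
  rw [Set.mem_iUnion]
  induction hj with
  | refl => exact ⟨0, rfl⟩
  | tail _ hbc ih =>
    obtain ⟨n, hn⟩ := ih
    exact ⟨n + 1, Set.mem_biUnion hn hbc⟩

/-- A partition of a space into open σ-compact sets. -/
structure IsSigmaCompactPartition {Ω : Type*} [TopologicalSpace Ω] {M : Type*}
    (W : M → Set Ω) : Prop where
  isOpen : ∀ μ, IsOpen (W μ)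
  disjoint : Pairwise fun μ ν => Disjoint (W μ) (W ν)
  iUnion_eq : (⋃ μ, W μ) = Set.univ
  isSigmaCompact : ∀ μ, IsSigmaCompact (W μ)

theorem isClosed_of_open_partition {Ω : Type*} [TopologicalSpace Ω] {M : Type*} {W : M → Set Ω}
    (ho : ∀ μ, IsOpen (W μ)) (hd : Pairwise fun μ ν => Disjoint (W μ) (W ν))
    (hu : (⋃ μ, W μ) = Set.univ) (μ : M) : IsClosed (W μ) := by
  have : (W μ)ᶜ = ⋃ ν : {ν // ν ≠ μ}, W ν := by
    ext t
    simp only [Set.mem_compl_iff, Set.mem_iUnion, Subtype.exists, exists_prop]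
    constructor
    · intro ht
      obtain ⟨ν, hν⟩ := Set.mem_iUnion.1 (hu ▸ Set.mem_univ t)
      exact ⟨ν, by rintro rfl; exact ht hν, hν⟩
    · rintro ⟨ν, hne, hν⟩ ht
      exact Set.disjoint_left.1 (hd hne) hν ht
  exact ⟨this ▸ isOpen_iUnion fun ν => ho ν⟩

/-- A compact set meets only finitely many members of an open partition. -/
theorem IsCompact.finite_meets_partition {Ω : Type*} [TopologicalSpace Ω] {M : Type*}
    {W : M → Set Ω} (ho : ∀ μ, IsOpen (W μ)) (hd : Pairwise fun μ ν => Disjoint (W μ) (W ν))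
    (hu : (⋃ μ, W μ) = Set.univ) {K : Set Ω} (hK : IsCompact K) :
    {μ | (W μ ∩ K).Nonempty}.Finite := by
  obtain ⟨s, hs⟩ := hK.elim_finite_subcover W ho (hu ▸ Set.subset_univ K)
  refine s.finite_toSet.subset ?_
  rintro μ ⟨t, hμ, ht⟩
  obtain ⟨ν, hν, htν⟩ := Set.mem_iUnion₂.1 (hs ht)
  by_contra hne
  exact Set.disjoint_left.1 (hd (fun h : ν = μ => hne (h ▸ hν))) htν hμ

/-- Join indices by chains of intersecting members. Each class is countable, and the unions over
different classes are disjoint. -/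
theorem exists_isSigmaCompactPartition {Ω : Type*} [TopologicalSpace Ω] {ι : Type u}
    (C : ι → Set Ω) (ho : ∀ i, IsOpen (C i)) (hu : (⋃ i, C i) = Set.univ)
    (hc : ∀ i, IsCompact (closure (C i))) (hr : ∀ i, {j | (C i ∩ C j).Nonempty}.Countable) :
    ∃ (M : Type u) (W : M → Set Ω), IsSigmaCompactPartition W := by
  let r : ι → ι → Prop := fun i j => (C i ∩ C j).Nonempty
  have hsymm : Std.Symm r := ⟨fun i j h => by
    change (C j ∩ C i).Nonempty
    rwa [Set.inter_comm]⟩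
  let S : Setoid ι :=
    { r := Relation.ReflTransGen r
      iseqv := ⟨fun _ => .refl, fun {i j} h => Relation.ReflTransGen.stdSymm.symm i j h,
        fun h h' => h.trans h'⟩ }
  let W : Quotient S → Set Ω := fun q => ⋃ i : {i // (⟦i⟧ : Quotient S) = q}, C i
  have hWo : ∀ q, IsOpen (W q) := fun q => isOpen_iUnion fun i => ho i
  have hWd : Pairwise fun p q => Disjoint (W p) (W q) := by
    intro p q hpq
    rw [Set.disjoint_left]
    intro t hp hq
    obtain ⟨⟨i, rfl⟩, hi⟩ := Set.mem_iUnion.1 hp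
    obtain ⟨⟨j, rfl⟩, hj⟩ := Set.mem_iUnion.1 hq
    exact hpq (Quotient.sound (Relation.ReflTransGen.single ⟨t, hi, hj⟩))
  have hWu : (⋃ q, W q) = Set.univ := by
    refine Set.eq_univ_of_forall fun t => ?_
    obtain ⟨i, hi⟩ := Set.mem_iUnion.1 (hu ▸ Set.mem_univ t)
    exact Set.mem_iUnion.2 ⟨⟦i⟧, Set.mem_iUnion.2 ⟨⟨i, rfl⟩, hi⟩⟩
  refine ⟨Quotient S, W, hWo, hWd, hWu, fun q => ?_⟩
  -- Each `W q` is also closed, so it absorbs the compact closures of its members.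
  have hcl : W q = ⋃ i : {i // (⟦i⟧ : Quotient S) = q}, closure (C i) := by
    refine subset_antisymm (Set.iUnion_mono fun i => subset_closure) ?_
    refine Set.iUnion_subset fun i => ?_
    exact closure_minimal (Set.subset_iUnion (fun i : {i // (⟦i⟧ : Quotient S) = q} => C i) i)
      (isClosed_of_open_partition hWo hWd hWu q)
  rw [hcl]
  have : Countable {i // (⟦i⟧ : Quotient S) = q} := by
    induction q using Quotient.inductionOn with
    | h i =>
      refine ((countable_reflTransGen r hr i).mono ?_).to_subtype
      intro j hj
      exact Setoid.symm (Quotient.exact (show (⟦j⟧ : Quotient S) = ⟦i⟧ from hj))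
  exact isSigmaCompact_iUnion_of_isCompact _ fun i => hc i

/-- Each piece is locally compact and σ-compact, hence paracompact. Refinements glue because each
point has its own piece as a neighbourhood disjoint from the others. -/
theorem IsSigmaCompactPartition.paracompactSpace {Ω : Type*} [TopologicalSpace Ω] [T2Space Ω]
    [LocallyCompactSpace Ω] {M : Type*} {W : M → Set Ω} (hW : IsSigmaCompactPartition W) :
    ParacompactSpace Ω := by
  refine ⟨fun α s ho hs => ?_⟩
  have hp : ∀ μ, ParacompactSpace (W μ) := by
    intro μ
    have := isSigmaCompact_iff_sigmaCompactSpace.1 (hW.isSigmaCompact μ)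
    have := (hW.isOpen μ).locallyCompactSpace
    infer_instance
  have href : ∀ μ, ∃ v : α → Set (W μ), (∀ a, IsOpen (v a)) ∧ (⋃ a, v a) = Set.univ ∧
      LocallyFinite v ∧ ∀ a, v a ⊆ Subtype.val ⁻¹' s a := by
    intro μ
    refine precise_refinement _ (fun a => (ho a).preimage continuous_subtype_val) ?_
    rw [← Set.preimage_iUnion, hs, Set.preimage_univ]
  choose v hvo hvu hvf hvs using href
  have hmem : ∀ t, ∃ μ, t ∈ W μ := fun t => Set.mem_iUnion.1 (hW.iUnion_eq ▸ Set.mem_univ t)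
  refine ⟨α, fun a => ⋃ μ, Subtype.val '' v μ a, fun a => ?_, ?_, ?_, fun a => ⟨a, ?_⟩⟩
  · exact isOpen_iUnion fun μ => (hW.isOpen μ).isOpenMap_subtype_val _ (hvo μ a)
  · refine Set.eq_univ_of_forall fun t => ?_
    obtain ⟨μ, hμ⟩ := hmem t
    obtain ⟨a, ha⟩ := Set.mem_iUnion.1 ((hvu μ).symm ▸ Set.mem_univ (⟨t, hμ⟩ : W μ))
    exact Set.mem_iUnion.2 ⟨a, Set.mem_iUnion.2 ⟨μ, _, ha, rfl⟩⟩
  · intro t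
    obtain ⟨μ, hμ⟩ := hmem t
    obtain ⟨N, hN, hfin⟩ := hvf μ ⟨t, hμ⟩
    refine ⟨Subtype.val '' N, (hW.isOpen μ).isOpenMap_subtype_val.image_mem_nhds hN,
      hfin.subset ?_⟩
    rintro a ⟨_, hx, ⟨y, hy, rfl⟩⟩
    obtain ⟨ν, z, hz, hzy⟩ := Set.mem_iUnion.1 hx
    obtain rfl : ν = μ := by
      by_contra hne
      exact Set.disjoint_left.1 (hW.disjoint hne) (hzy ▸ z.2) y.2
    obtain rfl : z = y := Subtype.ext hzy
    exact ⟨z, hz, hy⟩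
  · refine Set.iUnion_subset fun μ => ?_
    rintro _ ⟨y, hy, rfl⟩
    exact hvs μ a hy

/-- In a locally finite cover by relatively compact sets, each compact closure meets only finitely
many members. -/
theorem exists_isSigmaCompactPartition_of_paracompact (Ω : Type u) [TopologicalSpace Ω] [T2Space Ω]
    [LocallyCompactSpace Ω] [ParacompactSpace Ω] :
    ∃ (M : Type u) (W : M → Set Ω), IsSigmaCompactPartition W := by
  choose K hK hKt using fun t : Ω => exists_compact_mem_nhds t
  obtain ⟨v, hvo, hvu, hvf, hvK⟩ := precise_refinement (fun t => interior (K t))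
    (fun _ => isOpen_interior) (Set.eq_univ_of_forall fun t => Set.mem_iUnion.2
      ⟨t, mem_interior_iff_mem_nhds.2 (hKt t)⟩)
  have hc : ∀ t, IsCompact (closure (v t)) := fun t =>
    (hK t).of_isClosed_subset isClosed_closure
      (closure_minimal ((hvK t).trans interior_subset) (hK t).isClosed)
  refine exists_isSigmaCompactPartition v hvo hvu hc fun i => ?_
  refine ((hvf.finite_nonempty_inter_compact (hc i)).subset ?_).countable
  rintro j ⟨t, hi, hj⟩
  exact ⟨t, hj, subset_closure hi⟩

end Topology

/-! ### Restrictions and extensions of continuous fields -/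

namespace ContinuousField

variable {Ω : Type u} [TopologicalSpace Ω] {A : Ω → Type v} [∀ t, NonUnitalCStarAlgebra (A t)]

/-- Continuous vector fields over an open set with compact support extend by zero. -/
theorem exists_extension [T2Space Ω] (U : ContinuousField Ω A) {V K : Set Ω} (hV : IsOpen V)
    (hK : IsCompact K) (hKV : K ⊆ V) (y : ∀ t : V, A t) (hy : y ∈ (U.restrict V).Θ)
    (hyK : ∀ t : V, (t : Ω) ∉ K → y t = 0) :
    ∃ x : U.sectionAlgebra, (∀ t : V, (x : lp A ∞) t = y t) ∧
      ∀ t, t ∉ V → (x : lp A ∞) t = 0 := by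
  classical
  let x : ∀ t, A t := fun t => if h : t ∈ V then y ⟨t, h⟩ else 0
  have hxV : ∀ t : V, x t = y t := fun t => dif_pos t.2
  have hxK : ∀ t, t ∉ K → x t = 0 := by
    intro t ht
    by_cases h : t ∈ V
    · exact (hxV ⟨t, h⟩).trans (hyK _ ht)
    · exact dif_neg h
  have hx : x ∈ U.Θ := by
    refine U.mem_of_locally_approx x fun t ε hε => ?_
    by_cases h : t ∈ V
    · obtain ⟨x', hx', h'⟩ := hy ⟨t, h⟩ ε hε
      refine ⟨x', hx', ?_⟩
      rw [nhds_subtype_eq_comap, eventually_comap] at h'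
      filter_upwards [h', hV.mem_nhds h] with s hs hsV
      rw [show x s = y ⟨s, hsV⟩ from hxV ⟨s, hsV⟩]
      exact hs ⟨s, hsV⟩ rfl
    · refine ⟨0, zero_mem _, ?_⟩
      filter_upwards [hK.isClosed.isOpen_compl.mem_nhds (fun h' => h (hKV h'))] with s hs
      simp [hxK s hs, hε.le]
  have hx0 : Tendsto (fun t => ‖x t‖) (cocompact Ω) (𝓝 0) := by
    refine tendsto_const_nhds.congr' ?_
    filter_upwards [hK.compl_mem_cocompact] with t ht
    rw [hxK t ht, norm_zero]
  obtain ⟨z, hz, hzx⟩ := U.exists_mem_sectionAlgebra x hx hx0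
  exact ⟨⟨z, hz⟩, fun t => (hzx t).trans (hxV t), fun t ht => (hzx t).trans (dif_neg ht)⟩

theorem Iso.norm_φ {A' : Ω → Type v} [∀ t, NonUnitalCStarAlgebra (A' t)]
    {U : ContinuousField Ω A} {U' : ContinuousField Ω A'} (e : Iso U U') (t : Ω) (a : A t) :
    ‖e.φ t a‖ = ‖a‖ :=
  NonUnitalStarAlgHom.norm_map (e.φ t) (e.φ t).injective a

theorem restrict_mem (U : ContinuousField Ω A) (V : Set Ω) {x : ∀ t, A t} (hx : x ∈ U.Θ) :
    (fun t : V => x t) ∈ (U.restrict V).Θ :=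
  fun _ ε hε => ⟨x, hx, by simp [hε.le]⟩

/-- A vector field along a continuous map `j` into a set over which the field is trivial is
continuous iff it is continuous in the trivialisation. -/
theorem continuous_along_iff (U : ContinuousField Ω A) {V : Set Ω} {B : Type v}
    [NonUnitalCStarAlgebra B] (e : Iso (U.restrict V) (const V B)) {T : Type*} [TopologicalSpace T]
    (j : T → V) (hj : Continuous j) (y : ∀ t, A (j t)) :
    (∀ t₀, ∀ ε : ℝ, 0 < ε → ∃ x ∈ U.Θ, ∀ᶠ t in 𝓝 t₀, ‖y t - x (j t)‖ ≤ ε) ↔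
      Continuous fun t => e.φ (j t) (y t) := by
  constructor
  · intro h
    refine (const T B).mem_of_locally_approx _ fun t₀ ε hε => ?_
    obtain ⟨x, hx, hxy⟩ := h t₀ ε hε
    refine ⟨fun t => e.φ (j t) (x (j t)), ?_, ?_⟩
    · have : Continuous fun s : V => e.φ s (x s) := (e.mem_iff _).1 (U.restrict_mem V hx)
      exact this.comp hj
    · filter_upwards [hxy] with t ht
      rwa [← map_sub, e.norm_φ]
  · intro h t₀ ε hε
    -- Near `t₀` the field `y` is close to the section that is constantly `b` in the trivialisation.
    set b := e.φ (j t₀) (y t₀) with hb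
    have hmem : (fun s : V => (e.φ s).symm b) ∈ (U.restrict V).Θ := by
      rw [e.mem_iff]
      simp only [StarAlgEquiv.apply_symm_apply]
      exact continuous_const
    obtain ⟨x, hx, hxb⟩ := hmem (j t₀) (ε / 2) (by positivity)
    refine ⟨x, hx, ?_⟩
    have h1 := Metric.tendsto_nhds.1 (h.tendsto t₀) (ε / 2) (by positivity)
    filter_upwards [(hj.tendsto t₀).eventually hxb, h1] with t ht h1
    have h2 : ‖y t - (e.φ (j t)).symm b‖ < ε / 2 := by
      rw [← e.norm_φ, map_sub, StarAlgEquiv.apply_symm_apply, ← dist_eq_norm]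
      exact h1
    have := norm_sub_le_norm_sub_add_norm_sub (y t) ((e.φ (j t)).symm b) (x (j t))
    linarith

/-- Together with `continuous_along_iff` this moves triviality between iterated and single
restrictions. Sections of the induced field are themselves locally approximated by sections of `U`.
-/
theorem approx_restrict_iff (U : ContinuousField Ω A) (W : Set Ω) {T : Type*} [TopologicalSpace T]
    (j : T → W) (hj : Continuous j) (y : ∀ t, A (j t)) :
    (∀ t₀, ∀ ε : ℝ, 0 < ε → ∃ x ∈ (U.restrict W).Θ, ∀ᶠ t in 𝓝 t₀, ‖y t - x (j t)‖ ≤ ε) ↔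
      ∀ t₀, ∀ ε : ℝ, 0 < ε → ∃ x ∈ U.Θ, ∀ᶠ t in 𝓝 t₀, ‖y t - x (j t)‖ ≤ ε := by
  constructor
  · intro h t₀ ε hε
    obtain ⟨x', hx', h1⟩ := h t₀ (ε / 2) (by positivity)
    obtain ⟨x, hx, h2⟩ := hx' (j t₀) (ε / 2) (by positivity)
    refine ⟨x, hx, ?_⟩
    filter_upwards [h1, (hj.tendsto t₀).eventually h2] with t h1 h2
    have := norm_sub_le_norm_sub_add_norm_sub (y t) (x' (j t)) (x (j t))
    linarith
  · intro h t₀ ε hε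
    obtain ⟨x, hx, h1⟩ := h t₀ ε hε
    exact ⟨_, U.restrict_mem W hx, h1⟩

/-- A field that is trivial over `V` stays trivial after restriction to smaller sets. -/
theorem IsTrivial.restrict_restrict {U : ContinuousField Ω A} {V : Set Ω}
    (h : (U.restrict V).IsTrivial) {W : Set Ω} {S : Set W} (hS : ∀ t ∈ S, (t : Ω) ∈ V) :
    ((U.restrict W).restrict S).IsTrivial := by
  obtain ⟨B, _, ⟨e⟩⟩ := h
  let j : S → V := fun t => ⟨t, hS t t.2⟩
  refine ⟨B, inferInstance, ⟨⟨fun t => e.φ (j t), fun y => ?_⟩⟩⟩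
  exact (U.approx_restrict_iff W (fun t : S => (t : W)) continuous_subtype_val y).trans
    (U.continuous_along_iff e j (by fun_prop) y)

/-- Triviality of an iterated restriction is triviality over the corresponding subset. -/
theorem IsTrivial.restrict_image {U : ContinuousField Ω A} {W : Set Ω} {S : Set W}
    (h : ((U.restrict W).restrict S).IsTrivial) :
    (U.restrict (Subtype.val '' S : Set Ω)).IsTrivial := by
  obtain ⟨B, _, ⟨e⟩⟩ := h
  have hW : ∀ t : (Subtype.val '' S : Set Ω), (t : Ω) ∈ W := by
    rintro ⟨_, s, _, rfl⟩; exact s.2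
  have hS : ∀ t : (Subtype.val '' S : Set Ω), (⟨t, hW t⟩ : W) ∈ S := by
    rintro ⟨_, s, hs, rfl⟩; exact hs
  let j : (Subtype.val '' S : Set Ω) → S := fun t => ⟨⟨t, hW t⟩, hS t⟩
  refine ⟨B, inferInstance, ⟨⟨fun t => e.φ (j t), fun y => ?_⟩⟩⟩
  exact (U.approx_restrict_iff W (fun t => (j t : W)) (by fun_prop) y).symm.trans
    ((U.restrict W).continuous_along_iff e j (by fun_prop) y)

variable [T2Space Ω] [LocallyCompactSpace Ω]

/-- Cut-offs of the constant vector fields in a trivialisation. -/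
theorem exists_cutoff (U : ContinuousField Ω A) {V : Set Ω} (hV : IsOpen V) {B : Type v}
    [NonUnitalCStarAlgebra B] (e : Iso (U.restrict V) (const V B)) {O : Set Ω} (hO : IsOpen O)
    (hOV : O ⊆ V) {t₀ : Ω} (ht₀ : t₀ ∈ O) :
    ∃ g : C(Ω, ℝ), (∀ᶠ t in 𝓝 t₀, g t = 1) ∧ (∀ t, 0 ≤ g t ∧ g t ≤ 1) ∧ (∀ t, t ∉ O → g t = 0) ∧
      ∀ b : B, ∃ x : U.sectionAlgebra,
        (∀ t : V, (x : lp A ∞) t = (e.φ t).symm ((g t : ℂ) • b)) ∧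
        ∀ t, t ∉ O → (x : lp A ∞) t = 0 := by
  -- Two nested compact sets: `g` is to be 1 on the neighbourhood `K` of `t₀` and to vanish outside
  -- `K' ⊆ O`.
  obtain ⟨K, hK, htK, hKO⟩ := exists_compact_subset hO ht₀
  obtain ⟨K', hK', hKK', hK'O⟩ := exists_compact_between hK hO hKO
  obtain ⟨g, hg1, hg0, -, hg⟩ := exists_continuous_one_zero_of_isCompact hK
    isOpen_interior.isClosed_compl (Set.disjoint_compl_right_iff_subset.2 hKK')
  have hg0' : ∀ t, t ∉ K' → g t = 0 := fun t ht => hg0 fun h => ht (interior_subset h)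
  refine ⟨g, ?_, hg, fun t ht => hg0' t fun h => ht (hK'O h), fun b => ?_⟩
  · filter_upwards [isOpen_interior.mem_nhds htK] with t ht using hg1 (interior_subset ht)
  · obtain ⟨x, hx, hx'⟩ := U.exists_extension hV hK' (hK'O.trans hOV)
      (fun t => (e.φ t).symm ((g t : ℂ) • b)) (by
        rw [e.mem_iff]
        simp only [StarAlgEquiv.apply_symm_apply]
        change Continuous fun t : V => (g t : ℂ) • b
        fun_prop) (fun t ht => by simp [hg0' t ht])
    refine ⟨x, hx, fun t ht => ?_⟩
    by_cases h : t ∈ V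
    · have := hx ⟨t, h⟩
      simpa [hg0' t fun h' => ht (hK'O h')] using this
    · exact hx' t h

end ContinuousField

/-! ### Left projectivity forces local finiteness over trivialising sets -/

namespace ContinuousField

open scoped BoundedContinuousFunction

variable {Ω : Type u} [TopologicalSpace Ω] {A : Ω → Type v} [∀ t, NonUnitalCStarAlgebra (A t)]

theorem norm_apply_le (U : ContinuousField Ω A) (x : U.sectionAlgebra) (t : Ω) :
    ‖(x : lp A ∞) t‖ ≤ ‖x‖ :=
  lp.norm_apply_le_norm ENNReal.top_ne_zero (x : lp A ∞) t

/-- The sections of a field, read in a trivialisation over `V`. -/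
noncomputable def readIn (U : ContinuousField Ω A) {V : Set Ω} {B : Type v}
    [NonUnitalCStarAlgebra B] (e : Iso (U.restrict V) (const V B)) :
    U.sectionAlgebra →L[ℂ] (V →ᵇ B) :=
  LinearMap.mkContinuous
    { toFun := fun x => BoundedContinuousFunction.ofNormedAddCommGroup
        (fun t : V => e.φ t ((x : lp A ∞) t))
        ((e.mem_iff _).1 (U.restrict_mem V x.2.1)) ‖x‖
        (fun t => (e.norm_φ t _).trans_le (U.norm_apply_le x t))
      map_add' := fun x y => by
        ext t
        exact map_add (e.φ t) ((x : lp A ∞) t) ((y : lp A ∞) t)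
      map_smul' := fun c x => by
        ext t
        exact map_smul (e.φ t) c ((x : lp A ∞) t) } 1
    (fun x => by
      rw [one_mul]
      exact BoundedContinuousFunction.norm_ofNormedAddCommGroup_le _ (norm_nonneg x)
        (fun t => (e.norm_φ t _).trans_le (U.norm_apply_le x t)))

theorem readIn_apply (U : ContinuousField Ω A) {V : Set Ω} {B : Type v}
    [NonUnitalCStarAlgebra B] (e : Iso (U.restrict V) (const V B)) (x : U.sectionAlgebra) (t : V) :
    U.readIn e x t = e.φ t ((x : lp A ∞) t) := rfl

theorem readIn_mul (U : ContinuousField Ω A) {V : Set Ω} {B : Type v}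
    [NonUnitalCStarAlgebra B] (e : Iso (U.restrict V) (const V B)) (x y : U.sectionAlgebra) :
    U.readIn e (x * y) = U.readIn e x * U.readIn e y := by
  ext t
  exact map_mul (e.φ t) ((x : lp A ∞) t) ((y : lp A ∞) t)

theorem tendsto_norm_readIn (U : ContinuousField Ω A) {V : Set Ω} {B : Type v}
    [NonUnitalCStarAlgebra B] (e : Iso (U.restrict V) (const V B)) (x : U.sectionAlgebra) :
    Tendsto (fun t => ‖U.readIn e x t‖) (comap ((↑) : V → Ω) (cocompact Ω)) (𝓝 0) := by
  simp only [readIn_apply, e.norm_φ]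
  exact x.2.2.comp tendsto_comap

/-- Constant functions, as a bounded linear map. -/
noncomputable def constBCF (V E : Type*) [TopologicalSpace V] [NormedAddCommGroup E]
    [NormedSpace ℂ E] : E →L[ℂ] (V →ᵇ E) :=
  LinearMap.mkContinuous
    { toFun := fun b => BoundedContinuousFunction.const V b
      map_add' := fun _ _ => rfl
      map_smul' := fun _ _ => rfl } 1
    (fun b => by rw [one_mul]; exact BoundedContinuousFunction.norm_const_le b)

/-- The functions `F` of two variables in a trivialising set that agree on the diagonal with a
section and vanish at infinity in the second variable. -/
def kernelModule (U : ContinuousField Ω A) {V : Set Ω} {B : Type v}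
    [NonUnitalCStarAlgebra B] (e : Iso (U.restrict V) (const V B)) :
    Submodule ℂ ((V →ᵇ (V →ᵇ B)) × U.sectionAlgebra) where
  carrier := {p | (∀ s, p.1 s s = U.readIn e p.2 s) ∧
    ∀ s, Tendsto (fun t => ‖p.1 s t‖) (comap ((↑) : V → Ω) (cocompact Ω)) (𝓝 0)}
  add_mem' := by
    rintro p q ⟨hp, hp'⟩ ⟨hq, hq'⟩
    refine ⟨fun s => ?_, fun s => ?_⟩
    · simp [hp, hq]
    · refine squeeze_zero (fun _ => norm_nonneg _) (fun t => norm_add_le (p.1 s t) (q.1 s t)) ?_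
      simpa using (hp' s).add (hq' s)
  zero_mem' := by
    refine ⟨fun s => ?_, fun s => ?_⟩
    · simp
    · simpa using tendsto_const_nhds
  smul_mem' := by
    rintro c p ⟨hp, hp'⟩
    refine ⟨fun s => ?_, fun s => ?_⟩
    · simp [hp]
    · have : ∀ t, ‖(c • p).1 s t‖ = ‖c‖ * ‖p.1 s t‖ := fun t => norm_smul c (p.1 s t)
      simp only [this]
      simpa using (hp' s).const_mul ‖c‖

/-- Makes the kernel module a Banach space: uniform limits keep both the diagonal identity and the
decay at infinity. -/
theorem isClosed_kernelModule (U : ContinuousField Ω A) {V : Set Ω} {B : Type v}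
    [NonUnitalCStarAlgebra B] (e : Iso (U.restrict V) (const V B)) :
    IsClosed (U.kernelModule e : Set ((V →ᵇ (V →ᵇ B)) × U.sectionAlgebra)) := by
  have h1 : IsClosed {p : (V →ᵇ (V →ᵇ B)) × U.sectionAlgebra | ∀ s, p.1 s s = U.readIn e p.2 s} := by
    simp only [Set.ofPred_forall]
    refine isClosed_iInter fun s => isClosed_eq ?_ ?_
    · have h : Continuous fun p : (V →ᵇ (V →ᵇ B)) × U.sectionAlgebra => p.1 s :=
        (BoundedContinuousFunction.lipschitz_eval_const s).continuous.comp continuous_fst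
      exact (BoundedContinuousFunction.lipschitz_eval_const s).continuous.comp h
    · exact (BoundedContinuousFunction.lipschitz_eval_const s).continuous.comp
        ((U.readIn e).continuous.comp continuous_snd)
  refine isClosed_of_closure_subset fun p hp => ⟨?_, fun s => ?_⟩
  · exact closure_minimal (fun q hq => hq.1) h1 hp
  · rw [Metric.tendsto_nhds]
    intro ε hε
    obtain ⟨q, hq, hpq⟩ := Metric.mem_closure_iff.1 hp (ε / 2) (by positivity)
    filter_upwards [Metric.tendsto_nhds.1 (hq.2 s) (ε / 2) (by positivity)] with t ht
    rw [dist_zero_right, norm_norm] at ht ⊢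
    have h2 : dist (p.1 s t) (q.1 s t) ≤ dist p q :=
      ((BoundedContinuousFunction.dist_coe_le_dist t).trans
        (BoundedContinuousFunction.dist_coe_le_dist s)).trans (le_max_left _ _)
    rw [dist_eq_norm] at h2
    have := norm_le_norm_add_norm_sub' (p.1 s t) (q.1 s t)
    linarith

instance (U : ContinuousField Ω A) {V : Set Ω} {B : Type v}
    [NonUnitalCStarAlgebra B] (e : Iso (U.restrict V) (const V B)) :
    CompleteSpace (U.kernelModule e) :=
  (U.isClosed_kernelModule e).completeSpace_coe

/-- A section, as a function of two variables that depends on the first one only. -/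
noncomputable def leftFactor (U : ContinuousField Ω A) {V : Set Ω} {B : Type v}
    [NonUnitalCStarAlgebra B] (e : Iso (U.restrict V) (const V B)) :
    U.sectionAlgebra →L[ℂ] (V →ᵇ (V →ᵇ B)) × U.sectionAlgebra :=
  (((constBCF V B).compLeftContinuousBounded V).comp (U.readIn e)).prod
    (ContinuousLinearMap.id ℂ _)

theorem leftFactor_mul (U : ContinuousField Ω A) {V : Set Ω} {B : Type v}
    [NonUnitalCStarAlgebra B] (e : Iso (U.restrict V) (const V B)) (a b : U.sectionAlgebra) :
    U.leftFactor e (a * b) = U.leftFactor e a * U.leftFactor e b := by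
  refine Prod.ext ?_ rfl
  ext s t
  change U.readIn e (a * b) s = U.readIn e a s * U.readIn e b s
  rw [readIn_mul]
  rfl

theorem leftFactor_mul_mem (U : ContinuousField Ω A) {V : Set Ω} {B : Type v}
    [NonUnitalCStarAlgebra B] (e : Iso (U.restrict V) (const V B)) (a : U.sectionAlgebra)
    {p : (V →ᵇ (V →ᵇ B)) × U.sectionAlgebra} (hp : p ∈ U.kernelModule e) :
    U.leftFactor e a * p ∈ U.kernelModule e := by
  refine ⟨fun s => ?_, fun s => ?_⟩
  · change U.readIn e a s * p.1 s s = U.readIn e (a * p.2) s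
    rw [hp.1 s, readIn_mul]
    rfl
  · refine squeeze_zero (fun _ => norm_nonneg _)
      (fun t => norm_mul_le (U.readIn e a s) (p.1 s t)) ?_
    simpa using (hp.2 s).const_mul ‖U.readIn e a s‖

/-- Sections act on the kernel module through the first variable. -/
noncomputable def kernelAction (U : ContinuousField Ω A) {V : Set Ω} {B : Type v}
    [NonUnitalCStarAlgebra B] (e : Iso (U.restrict V) (const V B)) :
    LeftBanachModule U.sectionAlgebra (U.kernelModule e) where
  act := LinearMap.mkContinuous₂ (LinearMap.mk₂ ℂ
    (fun a p => (⟨U.leftFactor e a * p, U.leftFactor_mul_mem e a p.2⟩ : U.kernelModule e))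
    (fun a b p => Subtype.ext (by
      change U.leftFactor e (a + b) * p.1 = U.leftFactor e a * p.1 + U.leftFactor e b * p.1
      rw [map_add, add_mul]))
    (fun c a p => Subtype.ext (by
      change U.leftFactor e (c • a) * p.1 = c • (U.leftFactor e a * p.1)
      rw [map_smul, smul_mul_assoc]))
    (fun a p q => Subtype.ext (mul_add _ _ _))
    (fun c a p => Subtype.ext (mul_smul_comm c (U.leftFactor e a) (p : _ × _))))
    ‖U.leftFactor e‖ (fun a p => by
      change ‖U.leftFactor e a * (p : (V →ᵇ (V →ᵇ B)) × U.sectionAlgebra)‖ ≤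
        ‖U.leftFactor e‖ * ‖a‖ * ‖(p : (V →ᵇ (V →ᵇ B)) × U.sectionAlgebra)‖
      exact (norm_mul_le _ _).trans
        (mul_le_mul_of_nonneg_right ((U.leftFactor e).le_opNorm a) (norm_nonneg _)))
  act_mul a b p := Subtype.ext (by
    change U.leftFactor e (a * b) * p.1 = U.leftFactor e a * (U.leftFactor e b * p.1)
    rw [leftFactor_mul, mul_assoc])

theorem kernelAction_fst_apply (U : ContinuousField Ω A) {V : Set Ω} {B : Type v}
    [NonUnitalCStarAlgebra B] (e : Iso (U.restrict V) (const V B)) (a : U.sectionAlgebra)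
    (p : U.kernelModule e) (s t : V) :
    ((U.kernelAction e).act a p).1.1 s t = U.readIn e a s * p.1.1 s t := rfl

/-- A left projective section algebra has a splitting of the diagonal map over each trivialising
set. -/
theorem exists_kernel (U : ContinuousField Ω A) {V : Set Ω} {B : Type v}
    [NonUnitalCStarAlgebra B] (e : Iso (U.restrict V) (const V B))
    (hP : IsLeftProjective.{max u v, w} U.sectionAlgebra) :
    ∃ F : U.sectionAlgebra → (V →ᵇ (V →ᵇ B)),
      (∀ a b s t, F (a * b) s t = U.readIn e a s * F b s t) ∧
      (∀ a s, F a s s = U.readIn e a s) ∧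
      ∀ a s, Tendsto (fun t => ‖F a s t‖) (comap ((↑) : V → Ω) (cocompact Ω)) (𝓝 0) := by
  -- The linear right inverse sends `a` to the kernel `(s, t) ↦ a t`. It depends on the second
  -- variable, whereas sections act through the first.
  let σ : U.sectionAlgebra →L[ℂ] U.kernelModule e :=
    (((constBCF V (V →ᵇ B)).comp (U.readIn e)).prod (ContinuousLinearMap.id ℂ _)).codRestrict
      (U.kernelModule e) (fun a => ⟨fun s => rfl, fun s => U.tendsto_norm_readIn e a⟩)
  obtain ⟨ψ, h1, h2⟩ := hP.exists_splitting (U.kernelAction e)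
    ((ContinuousLinearMap.snd ℂ _ _).comp (U.kernelModule e).subtypeL) (fun a p => rfl) σ
    (fun b => rfl)
  refine ⟨fun a => (ψ a).1.1, fun a b s t => ?_, fun a s => ?_, fun a s => (ψ a).2.2 s⟩
  · exact (congrArg (fun p : U.kernelModule e => p.1.1 s t) (h1 a b)).trans
      (U.kernelAction_fst_apply e a (ψ b) s t)
  · rw [(ψ a).2.1 s]
    exact congrArg (fun x => U.readIn e x s) (h2 a)

variable [T2Space Ω] [LocallyCompactSpace Ω]

/-- If the section algebra is left projective then a set `V` over which the field is trivial is
covered by open sets that are relatively compact in the base and form a locally finite family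
in `V`. -/
theorem exists_locallyFinite_cover (U : ContinuousField Ω A) [∀ t, Nontrivial (A t)] {V : Set Ω}
    (hV : IsOpen V) (hT : (U.restrict V).IsTrivial)
    (hP : IsLeftProjective.{max u v, w} U.sectionAlgebra) :
    ∃ D : V → Set Ω, (∀ s, IsOpen (D s)) ∧ V ⊆ ⋃ s, D s ∧ (∀ s, IsCompact (closure (D s))) ∧
      ∀ t ∈ V, ∃ N ∈ 𝓝 t, {s | (D s ∩ N).Nonempty}.Finite := by
  obtain ⟨B, _, ⟨e⟩⟩ := hT
  obtain ⟨F, hFmul, hFdiag, hFinf⟩ := U.exists_kernel e hP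
  rcases V.eq_empty_or_nonempty with rfl | ⟨v₀, hv₀⟩
  · exact ⟨fun _ => ∅, by simp⟩
  obtain ⟨a₀, ha₀⟩ := exists_ne (0 : A v₀)
  set b := e.φ ⟨v₀, hv₀⟩ a₀ with hb
  have hb0 : 0 < ‖star b * b‖ := by
    rw [CStarRing.norm_star_mul_self, hb, e.norm_φ]
    have := norm_pos_iff.2 ha₀
    positivity
  choose g hg1 hg hg0 x hx hx0 using fun s : V => U.exists_cutoff hV e hV subset_rfl s.2
  have hx' : ∀ s c (t : V), U.readIn e (x s c) t = (g s t : ℂ) • c := fun s c t => by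
    rw [readIn_apply, hx, StarAlgEquiv.apply_symm_apply]
  -- the value at `t` of the kernel does not depend on the cut-off function
  have hindep : ∀ s s' t : V, g s t = 1 → g s' t = 1 → ∀ r,
      star b * F (x s b) t r = star b * F (x s' b) t r := by
    intro s s' t h h' r
    -- In the trivialisation both products are `g s * g s'` times `star b * b`. Since `F` respects
    -- left multiplication only, the factor `star b` is what allows the two cut-offs to be
    -- exchanged.
    have hcomm : x s (star b) * x s' b = x s' (star b) * x s b := by
      refine Subtype.ext (lp.ext (funext fun q => ?_))
      change (x s (star b) : lp A ∞) q * (x s' b : lp A ∞) q =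
        (x s' (star b) : lp A ∞) q * (x s b : lp A ∞) q
      by_cases hq : q ∈ V
      · rw [hx s _ ⟨q, hq⟩, hx s' _ ⟨q, hq⟩, hx s _ ⟨q, hq⟩, hx s' _ ⟨q, hq⟩, ← map_mul, ← map_mul,
          smul_mul_smul_comm, smul_mul_smul_comm, mul_comm (g s _ : ℂ)]
      · rw [hx0 s (star b) q hq, hx0 s b q hq, zero_mul, mul_zero]
    have := congrArg (fun z => F z t r) hcomm
    simp only [hFmul, hx', h, h', Complex.ofReal_one, one_smul] at this
    exact this.symm
  let k : V → (V →ᵇ B) := fun s => BoundedContinuousFunction.const V (star b) * F (x s b) s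
  have hkr : ∀ s r, k s r = star b * F (x s b) s r := fun s r => rfl
  have hkcont : Continuous k := by
    rw [continuous_iff_continuousAt]
    intro s
    -- Although the cut-off varies with the point, near `s` the one chosen at `s` serves for all
    -- points, by `hindep`.
    have h1 : ContinuousAt (fun t => BoundedContinuousFunction.const V (star b) * F (x s b) t) s :=
      (continuous_const.mul (F (x s b)).continuous).continuousAt
    refine h1.congr ?_
    filter_upwards [(continuous_subtype_val.tendsto s).eventually (hg1 s)] with t ht
    ext r
    exact hindep s t t ht (hg1 t).self_of_nhds r
  have hkdiag : ∀ s, k s s = star b * b := fun s => by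
    rw [hkr, hFdiag, hx', (hg1 s).self_of_nhds]; simp
  have hkinf : ∀ s, Tendsto (fun t => ‖k s t‖) (comap ((↑) : V → Ω) (cocompact Ω)) (𝓝 0) := by
    intro s
    refine squeeze_zero (fun _ => norm_nonneg _) (fun t => norm_mul_le (star b) _) ?_
    simpa using (hFinf (x s b) s).const_mul ‖star b‖
  set r := ‖star b * b‖ / 2 with hr
  -- The range of `k` is metrisable, hence paracompact whatever `V` is. The radius `r` is half the
  -- constant diagonal value.
  obtain ⟨v, hvo, hvu, hvf, hvs⟩ := precise_refinement
    (fun s : V => {z : Set.range k | dist (z : V →ᵇ B) (k s) < r})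
    (fun s => isOpen_lt (by fun_prop) continuous_const) (by
      refine Set.eq_univ_of_forall ?_
      rintro ⟨_, s, rfl⟩
      refine Set.mem_iUnion.2 ⟨s, ?_⟩
      simp [hr, hb0])
  have hk' : Continuous (Set.rangeFactorization k) := by
    exact hkcont.subtype_mk _
  refine ⟨fun s => Subtype.val '' (Set.rangeFactorization k ⁻¹' v s), fun s => ?_, fun t ht => ?_,
    fun s => ?_, fun t ht => ?_⟩
  · exact hV.isOpenMap_subtype_val _ ((hvo s).preimage hk')
  · obtain ⟨s, hs⟩ := Set.mem_iUnion.1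
      (hvu.symm ▸ Set.mem_univ (Set.rangeFactorization k ⟨t, ht⟩))
    exact Set.mem_iUnion.2 ⟨s, ⟨t, ht⟩, hs, rfl⟩
  -- If `k t` is within `r` of `k s`, evaluation at `t` gives `‖k s t‖ > r`; this confines `t` to a
  -- compact set depending only on `s`.
  · have h1 := (hkinf s).eventually_lt_const (u := r) (by positivity)
    obtain ⟨T, hT, hTs⟩ := mem_comap.1 h1
    obtain ⟨K, hK, hKT⟩ := mem_cocompact.1 hT
    refine hK.of_isClosed_subset isClosed_closure (closure_minimal ?_ hK.isClosed)
    rintro _ ⟨t, ht, rfl⟩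
    by_contra hn
    have h2 : ‖k s t‖ < r := hTs (show (t : Ω) ∈ T from hKT hn)
    have h3 : dist (k t) (k s) < r := hvs s ht
    have h4 := (BoundedContinuousFunction.dist_coe_le_dist t).trans_lt h3
    rw [dist_eq_norm, hkdiag] at h4
    have := norm_le_norm_add_norm_sub' (star b * b) (k s t)
    linarith
  · obtain ⟨N, hN, hfin⟩ := hvf (Set.rangeFactorization k ⟨t, ht⟩)
    refine ⟨Subtype.val '' (Set.rangeFactorization k ⁻¹' N),
      hV.isOpenMap_subtype_val.image_mem_nhds (hk'.continuousAt.preimage_mem_nhds hN),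
      hfin.subset ?_⟩
    rintro s ⟨_, ⟨y, hy, rfl⟩, z, hz, hzy⟩
    obtain rfl : z = y := Subtype.ext hzy
    exact ⟨_, hy, hz⟩

end ContinuousField

/-! ### Paracompactness and σ-local triviality -/

namespace ContinuousField

variable {Ω : Type u} [TopologicalSpace Ω] {A : Ω → Type v} [∀ t, NonUnitalCStarAlgebra (A t)]

/-- Transports the covers from the subspace to `Ω`. Closedness of `W` makes closures in `W` closures
in `Ω`. -/
theorem IsSigmaLocallyTrivial.exists_cover {U : ContinuousField Ω A} {W : Set Ω} (ho : IsOpen W)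
    (hc : IsClosed W) (h : (U.restrict W).IsSigmaLocallyTrivial) :
    ∃ (J : Type) (_ : Countable J) (V S : J → Set Ω), (∀ j, IsOpen (V j)) ∧ (∀ j, IsOpen (S j)) ∧
      (⋃ j, V j) = W ∧ (∀ j, closure (V j) ⊆ S j) ∧ ∀ j, (U.restrict (S j)).IsTrivial := by
  obtain ⟨M, S, hSo, -, hSt, J, hJ, V, hVo, hVu, hVS⟩ := h
  choose μ hμ using hVS
  refine ⟨J, hJ, fun j => Subtype.val '' V j, fun j => Subtype.val '' S (μ j), fun j => ?_,
    fun j => ?_, ?_, fun j => ?_, fun j => (hSt (μ j)).restrict_image⟩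
  · exact ho.isOpenMap_subtype_val _ (hVo j)
  · exact ho.isOpenMap_subtype_val _ (hSo (μ j))
  · rw [← Set.image_iUnion, hVu, Set.image_univ, Subtype.range_coe]
  · rw [hc.isClosedEmbedding_subtypeVal.closure_image_eq]
    exact Set.image_mono (hμ j)

theorem paracompactSpace_of_isLeftProjective [T2Space Ω] [LocallyCompactSpace Ω]
    [∀ t, Nontrivial (A t)] (U : ContinuousField Ω A)
    (hP : IsLeftProjective.{max u v, w} U.sectionAlgebra)
    (hD : U.IsDisjointUnionOfSigmaLocallyTrivial) : ParacompactSpace Ω := by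
  obtain ⟨M, W, hWo, hWd, hWu, hWs⟩ := hD
  choose J hJ V S hVo hSo hVW hVS hSt using fun μ =>
    IsSigmaLocallyTrivial.exists_cover (hWo μ) (isClosed_of_open_partition hWo hWd hWu μ) (hWs μ).1
  choose D hDo hDu hDc hDf using fun μ j => U.exists_locallyFinite_cover (hSo μ j) (hSt μ j) hP
  -- The sets `D μ j s` are locally finite only inside `S μ j`. Cutting down to `V μ j`, whose
  -- closure lies in `S μ j`, makes compact subsets of `Ω` meet finitely many.
  have hfin : ∀ μ j (K : Set Ω), IsCompact K → {s | (D μ j s ∩ V μ j ∩ K).Nonempty}.Finite := by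
    intro μ j K hK
    choose! N hN hNf using hDf μ j
    obtain ⟨F, hKF⟩ := (hK.inter_left (isClosed_closure (s := V μ j))).elim_nhds_subcover'
      (fun t ht => N t) (fun t ht => hN t (hVS μ j ht.1))
    refine (F.finite_toSet.biUnion fun t _ => hNf t (hVS μ j t.2.1)).subset ?_
    rintro s ⟨x, ⟨hxD, hxV⟩, hxK⟩
    obtain ⟨t, ht, hxt⟩ := Set.mem_iUnion₂.1 (hKF ⟨subset_closure hxV, hxK⟩)
    exact Set.mem_biUnion ht ⟨x, hxD, hxt⟩
  let C : (Σ μ, Σ j : J μ, S μ j) → Set Ω := fun i => D i.1 i.2.1 i.2.2 ∩ V i.1 i.2.1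
  have hCc : ∀ i, IsCompact (closure (C i)) := fun i =>
    (hDc i.1 i.2.1 i.2.2).of_isClosed_subset isClosed_closure (closure_mono Set.inter_subset_left)
  have hVsub : ∀ μ j, V μ j ⊆ W μ := fun μ j => hVW μ ▸ Set.subset_iUnion (V μ) j
  have hCu : (⋃ i, C i) = Set.univ := by
    refine Set.eq_univ_of_forall fun t => ?_
    obtain ⟨μ, hμ⟩ := Set.mem_iUnion.1 (hWu ▸ Set.mem_univ t)
    obtain ⟨j, hj⟩ := Set.mem_iUnion.1 ((hVW μ).symm ▸ hμ)
    obtain ⟨s, hs⟩ := Set.mem_iUnion.1 (hDu μ j (hVS μ j (subset_closure hj)))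
    exact Set.mem_iUnion.2 ⟨⟨μ, j, s⟩, hs, hj⟩
  have hCr : ∀ i, {j | (C i ∩ C j).Nonempty}.Countable := by
    intro i
    -- Finitely many pieces, countably many `j` in each, finitely many `s` for each `j`.
    have h1 : (⋃ μ ∈ {μ | (W μ ∩ closure (C i)).Nonempty}, ⋃ j : J μ,
        (fun s => (⟨μ, j, s⟩ : Σ μ, Σ j : J μ, S μ j)) ''
          {s | (D μ j s ∩ V μ j ∩ closure (C i)).Nonempty}).Countable := by
      refine ((hCc i).finite_meets_partition hWo hWd hWu).countable.biUnion fun μ _ => ?_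
      have := hJ μ
      exact Set.countable_iUnion fun j => ((hfin μ j _ (hCc i)).image _).countable
    refine h1.mono ?_
    rintro ⟨μ, j, s⟩ ⟨t, hti, htD, htV⟩
    refine Set.mem_biUnion (x := μ) ⟨t, hVsub μ j htV, subset_closure hti⟩ ?_
    exact Set.mem_iUnion.2 ⟨j, s, ⟨t, ⟨htD, htV⟩, subset_closure hti⟩, rfl⟩
  obtain ⟨M', W', hW'⟩ := exists_isSigmaCompactPartition C
    (fun i => (hDo _ _ _).inter (hVo _ _)) hCu hCc hCr
  exact hW'.paracompactSpace

/-- Over a paracompact base, a locally trivial field is a disjoint union of σ-locally trivial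
ones. -/
theorem isDisjointUnionOfSigmaLocallyTrivial [T2Space Ω] [LocallyCompactSpace Ω]
    (U : ContinuousField Ω A) (hU : U.IsLocallyTrivial) (hpos : U.HasStrictlyPositiveElements)
    {M : Type u} {W : M → Set Ω} (hW : IsSigmaCompactPartition W) :
    U.IsDisjointUnionOfSigmaLocallyTrivial := by
  refine ⟨M, W, hW.isOpen, hW.disjoint, hW.iUnion_eq, fun μ => ⟨?_, fun t => hpos t⟩⟩
  choose V hVo hVt hV using hU
  have := isSigmaCompact_iff_sigmaCompactSpace.1 (hW.isSigmaCompact μ)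
  have := (hW.isOpen μ).locallyCompactSpace
  let S : W μ → Set (W μ) := fun t => Subtype.val ⁻¹' V t
  have hSo : ∀ t, IsOpen (S t) := fun t => (hVo t).preimage continuous_subtype_val
  have hSt : ∀ t : W μ, t ∈ S t := fun t => hVt t
  refine ⟨W μ, S, hSo, Set.eq_univ_of_forall fun t => Set.mem_iUnion.2 ⟨t, hSt t⟩,
    fun t => (hV t).restrict_restrict fun _ h => h, ?_⟩
  choose K hK htK hKS using fun t => exists_compact_subset (hSo t) (hSt t)
  obtain ⟨s, hsc, hsu⟩ := countable_cover_nhds_of_sigmaCompact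
    (fun t => isOpen_interior.mem_nhds (htK t))
  rcases s.eq_empty_or_nonempty with rfl | hne
  · refine ⟨Empty, inferInstance, Empty.elim, fun j => j.elim, ?_, fun j => j.elim⟩
    rw [← hsu]; simp
  · obtain ⟨f, rfl⟩ := hsc.exists_eq_range hne
    refine ⟨ℕ, inferInstance, fun n => interior (K (f n)), fun n => isOpen_interior, ?_,
      fun n => ⟨f n, (closure_minimal interior_subset (hK _).isClosed).trans (hKS _)⟩⟩
    rw [← hsu, Set.biUnion_range]

end ContinuousField

/-! ### States and strictly positive elements -/

section States

variable {D : Type*} [CStarAlgebra D]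

/-- Compare `φ` at `x + i t` with the norm: both squares contain at most `t ^ 2`, so the cross term
`2 t Im (φ x)` must vanish. -/
theorem im_apply_eq_zero_of_norm_le_one {φ : D →L[ℂ] ℂ} (hφ : ‖φ‖ ≤ 1) (h1 : φ 1 = 1) {x : D}
    (hx : IsSelfAdjoint x) : (φ x).im = 0 := by
  have key : ∀ t : ℝ, ((φ x).im + t) ^ 2 ≤ ‖x‖ ^ 2 * ‖(1 : D)‖ + t ^ 2 * ‖(1 : D)‖ + ‖x‖ ^ 2 := by
    intro t
    have h2 : φ (x + (t * Complex.I : ℂ) • 1) = φ x + t * Complex.I := by simp [h1]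
    have h3 : ‖φ (x + (t * Complex.I : ℂ) • 1)‖ ≤ ‖x + (t * Complex.I : ℂ) • (1 : D)‖ := by
      simpa using φ.le_of_opNorm_le hφ (x + (t * Complex.I : ℂ) • 1)
    have h4 : star (x + (t * Complex.I : ℂ) • (1 : D)) * (x + (t * Complex.I : ℂ) • 1)
        = x * x + ((t ^ 2 : ℝ) : ℂ) • 1 := by
      have hI : -(t * Complex.I : ℂ) * (t * Complex.I) = ((t ^ 2 : ℝ) : ℂ) := by
        push_cast; ring_nf; simp
      simp only [star_add, hx.star_eq, star_smul, star_one, add_mul, mul_add, smul_mul_assoc,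
        mul_smul_comm, one_mul, mul_one]
      have : star (t * Complex.I : ℂ) = -(t * Complex.I) := by simp
      rw [this, ← hI]
      module
    have h5 : ‖x + (t * Complex.I : ℂ) • (1 : D)‖ ^ 2 ≤ ‖x‖ ^ 2 + t ^ 2 * ‖(1 : D)‖ := by
      rw [sq, ← CStarRing.norm_star_mul_self, h4]
      refine (norm_add_le _ _).trans ?_
      rw [norm_smul, Complex.norm_real, Real.norm_eq_abs, abs_of_nonneg (sq_nonneg t), sq ‖x‖]
      gcongr
      exact norm_mul_le _ _
    have h6 : ((φ x).im + t) ^ 2 ≤ ‖φ (x + (t * Complex.I : ℂ) • 1)‖ ^ 2 := by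
      rw [h2]
      have : (φ x).im + t = (φ x + t * Complex.I).im := by simp
      rw [this, ← sq_abs]
      gcongr
      exact Complex.abs_im_le_norm _
    have h7 := pow_le_pow_left₀ (norm_nonneg _) h3 2
    have : 0 ≤ ‖x‖ ^ 2 * ‖(1 : D)‖ := by positivity
    linarith
  have hone : ‖(1 : D)‖ ≤ 1 := by
    have : ‖(1 : D)‖ * ‖(1 : D)‖ = ‖(1 : D)‖ := by
      rw [← CStarRing.norm_star_mul_self]; simp
    nlinarith [norm_nonneg (1 : D)]
  by_contra hne
  set y := (φ x).im
  have hy : 0 < y ^ 2 := by positivity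
  -- This `t` makes the cross term `2 (‖x‖ ^ 2 + 1)`, more than the available `2 ‖x‖ ^ 2`.
  have h := key ((‖x‖ ^ 2 + 1) / y)
  have e : (y + (‖x‖ ^ 2 + 1) / y) ^ 2 = y ^ 2 + 2 * (‖x‖ ^ 2 + 1) + ((‖x‖ ^ 2 + 1) / y) ^ 2 := by
    field_simp
    ring
  rw [e] at h
  have h8 : ‖x‖ ^ 2 * ‖(1 : D)‖ ≤ ‖x‖ ^ 2 * 1 := by gcongr
  have h9 : ((‖x‖ ^ 2 + 1) / y) ^ 2 * ‖(1 : D)‖ ≤ ((‖x‖ ^ 2 + 1) / y) ^ 2 * 1 := by gcongr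
  nlinarith

variable [PartialOrder D] [StarOrderedRing D]

/-- Positivity of `x` puts `‖x‖ - x` in the ball of radius `‖x‖`, so `φ x` lies in the disc of that
radius about `‖x‖`. -/
theorem re_apply_nonneg_of_norm_le_one {φ : D →L[ℂ] ℂ} (hφ : ‖φ‖ ≤ 1) (h1 : φ 1 = 1) {x : D}
    (hx : 0 ≤ x) : 0 ≤ (φ x).re := by
  have h2 : ‖algebraMap ℝ D ‖x‖ - x‖ ≤ ‖x‖ := by
    have hle : x ≤ algebraMap ℝ D ‖x‖ := IsSelfAdjoint.le_algebraMap_norm_self (.of_nonneg hx)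
    rw [CStarAlgebra.norm_le_iff_le_algebraMap _ (norm_nonneg x) (sub_nonneg.2 hle)]
    exact sub_le_self _ hx
  have h3 : φ (algebraMap ℝ D ‖x‖ - x) = ‖x‖ - φ x := by
    have : algebraMap ℝ D ‖x‖ = (‖x‖ : ℂ) • (1 : D) := by
      rw [Algebra.algebraMap_eq_smul_one, Complex.coe_smul]
    rw [map_sub, this, map_smul, h1, smul_eq_mul, mul_one]
  have h4 := φ.le_of_opNorm_le hφ (algebraMap ℝ D ‖x‖ - x)
  rw [one_mul] at h4
  replace h4 := h4.trans h2
  rw [h3] at h4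
  have h5 := (Complex.abs_re_le_norm _).trans h4
  rw [Complex.sub_re, Complex.ofReal_re, abs_le] at h5
  linarith

open scoped ComplexOrder in
/-- Every positive element is normed by a state. -/
theorem exists_state_apply_eq_norm [Nontrivial D] {p : D} (hp : 0 ≤ p) :
    ∃ φ : D →L[ℂ] ℂ, ‖φ‖ ≤ 1 ∧ φ 1 = 1 ∧ φ p = ‖p‖ := by
  -- A functional norming `1 + p` works: since `‖1 + p‖ ≥ 1 + ‖p‖`, equality holds in both `‖φ 1‖ ≤
  -- 1` and `‖φ p‖ ≤ ‖p‖`.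
  obtain ⟨φ, hφ, hφp⟩ := exists_dual_vector'' ℂ (1 + p)
  have hn : 1 + ‖p‖ ≤ ‖1 + p‖ := by
    have h1 := CStarAlgebra.norm_mem_spectrum_of_nonneg hp
    have h2 : 1 + ‖p‖ ∈ spectrum ℝ (1 + p) := by
      have := spectrum.add_mem_add_iff (R := ℝ) (a := p) (r := ‖p‖) (s := 1)
      simpa [add_comm] using this.2 h1
    have h3 := spectrum.norm_le_norm_of_mem h2
    rwa [Real.norm_of_nonneg (by positivity)] at h3
  have h1 : ‖φ 1‖ ≤ 1 := by simpa using φ.le_of_opNorm_le hφ 1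
  have h2 : ‖φ p‖ ≤ ‖p‖ := by simpa using φ.le_of_opNorm_le hφ p
  have h3 : φ 1 + φ p = ((‖1 + p‖ : ℝ) : ℂ) := by rw [← map_add]; exact hφp
  have h4 := congrArg Complex.re h3
  rw [Complex.add_re, Complex.ofReal_re] at h4
  have h5 := Complex.re_le_norm (φ 1)
  have h6 := Complex.re_le_norm (φ p)
  have aux : ∀ (z : ℂ) (r : ℝ), ‖z‖ ≤ r → z.re = r → z = r := by
    intro z r hz hr
    have h7 : z.re = ‖z‖ := le_antisymm (Complex.re_le_norm z) (by rw [hr]; exact hz)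
    have h8 : 0 ≤ z := Complex.re_eq_norm.1 h7
    rw [← hr]
    exact Complex.ext rfl (by simpa using (Complex.nonneg_iff.1 h8).2.symm)
  refine ⟨φ, hφ, ?_, aux _ _ h2 (by linarith)⟩
  have := aux _ _ h1 (by linarith)
  simpa using this

end States

/-! ### Approximate units from strictly positive elements -/

section StrictlyPositive

/-- The piecewise linear function that vanishes up to `2⁻ⁿ` and is `1` from `2¹⁻ⁿ` on. -/
noncomputable def ramp (n : ℕ) (x : ℝ) : ℝ := max 0 (min 1 (2 ^ n * x - 1))

theorem continuous_ramp (n : ℕ) : Continuous (ramp n) := by unfold ramp; fun_prop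

theorem ramp_zero_right (n : ℕ) : ramp n 0 = 0 := by simp [ramp]

theorem ramp_nonneg (n : ℕ) (x : ℝ) : 0 ≤ ramp n x := le_max_left _ _

theorem ramp_le_one (n : ℕ) (x : ℝ) : ramp n x ≤ 1 := by simp [ramp]

theorem ramp_eq_zero {n : ℕ} {x : ℝ} (h : 2 ^ n * x ≤ 1) : ramp n x = 0 :=
  max_eq_left ((min_le_right _ _).trans (by linarith))

theorem ramp_eq_one {n : ℕ} {x : ℝ} (h : 2 ≤ 2 ^ n * x) : ramp n x = 1 := by
  rw [ramp, min_eq_left (by linarith), max_eq_right zero_le_one]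

/-- `ramp m` lives where `x > 2⁻ᵐ`, and `2¹⁻ⁿ ≤ 2⁻ᵐ`. -/
theorem ramp_eq_one_of_ne_zero {m n : ℕ} (hmn : m < n) {x : ℝ} (h : ramp m x ≠ 0) :
    ramp n x = 1 := by
  have h1 : 1 < 2 ^ m * x := by
    by_contra hle
    exact h (ramp_eq_zero (not_lt.1 hle))
  refine ramp_eq_one ?_
  have hx : 0 < x := pos_of_mul_pos_right (zero_lt_one.trans h1) (by positivity)
  have h2 : (2 : ℝ) ^ (m + 1) ≤ 2 ^ n := pow_le_pow_right₀ one_le_two hmn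
  calc (2 : ℝ) ≤ 2 ^ (m + 1) * x := by rw [pow_succ]; linarith
    _ ≤ 2 ^ n * x := by gcongr

theorem abs_mul_one_sub_ramp_le (n : ℕ) {x : ℝ} (hx : 0 ≤ x) :
    |x * (1 - ramp n x)| ≤ 2 / 2 ^ n := by
  have h0 := ramp_nonneg n x
  have h1 := ramp_le_one n x
  rw [abs_of_nonneg (mul_nonneg hx (by linarith))]
  rcases le_total 2 (2 ^ n * x) with h | h
  · rw [ramp_eq_one h]; simp; positivity
  · rw [le_div_iff₀ (by positivity)]
    nlinarith [mul_nonneg (mul_nonneg hx h0) (by positivity : (0 : ℝ) ≤ 2 ^ n)]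

variable {B : Type v} [NonUnitalCStarAlgebra B]

theorem IsStrictlyPositiveElement.isSelfAdjoint {h : B} (hh : IsStrictlyPositiveElement h) :
    IsSelfAdjoint h := by
  obtain ⟨⟨b, rfl⟩, -⟩ := hh
  exact IsSelfAdjoint.star_mul_self b

theorem quasispectrum_star_mul_self_nonneg (b : B) {x : ℝ}
    (hx : x ∈ quasispectrum ℝ (star b * b)) : 0 ≤ x := by
  let _ := CStarAlgebra.spectralOrder B
  have := CStarAlgebra.spectralOrderedRing B
  exact quasispectrum_nonneg_of_nonneg _ (star_mul_self_nonneg b) x hx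

theorem cfcₙ_mul_one_sub_ramp {h : B} (hsa : IsSelfAdjoint h) (n : ℕ) :
    cfcₙ (fun x => x * (1 - ramp n x)) h = h - cfcₙ (ramp n) h * h := by
  have hr := (continuous_ramp n).continuousOn (s := quasispectrum ℝ h)
  have hr' : ContinuousOn (fun x => ramp n x * x) (quasispectrum ℝ h) := hr.mul continuousOn_id
  have e1 : cfcₙ (fun x : ℝ => x) h = h := cfcₙ_id' ℝ h
  have e2 : cfcₙ (fun x => ramp n x * x) h = cfcₙ (ramp n) h * cfcₙ (fun x => x) h :=
    cfcₙ_mul (ramp n) (fun x => x) h hr (ramp_zero_right n) continuousOn_id rfl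
  have e3 : cfcₙ (fun x => x - ramp n x * x) h
      = cfcₙ (fun x => x) h - cfcₙ (fun x => ramp n x * x) h :=
    cfcₙ_sub (fun x => x) (fun x => ramp n x * x) h continuousOn_id rfl hr' (by simp)
  rw [e2, e1] at e3
  rw [← e3]
  congr 1
  funext x
  ring

/-- The functional calculus of a strictly positive element contains an approximate unit. -/
theorem IsStrictlyPositiveElement.exists_norm_sub_mul_cfcₙ_ramp_lt {h : B}
    (hh : IsStrictlyPositiveElement h) (a : B) {ε : ℝ} (hε : 0 < ε) :
    ∃ n, ‖a - a * cfcₙ (ramp n) h‖ < ε := by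
  by_contra! hcon
  have hsa := hh.isSelfAdjoint
  obtain ⟨⟨b₀, hb₀⟩, hstr⟩ := hh
  -- Work with the defects `c n = 1 - ramp n (h)` in the unitization. States norming `c n * star a *
  -- a * c n` give positive functionals `ω n` on `B` that are at least `ε ^ 2` at `star a * a`,
  -- while `ω n h` tends to 0.
  let c : ℕ → Unitization ℂ B := fun n => 1 - (cfcₙ (ramp n) h : B)
  have hcsa : ∀ n, IsSelfAdjoint (c n) := fun n =>
    (IsSelfAdjoint.one _).sub ((cfcₙ_predicate (ramp n) h).inr ℂ)
  have hcn : ∀ n, ‖c n‖ ≤ 2 := by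
    intro n
    refine (norm_sub_le _ _).trans ?_
    rw [Unitization.norm_inr, norm_one]
    have : ‖cfcₙ (ramp n) h‖ ≤ 1 := norm_cfcₙ_le fun x _ => by
      rw [Real.norm_of_nonneg (ramp_nonneg n x)]; exact ramp_le_one n x
    linarith
  have hp : ∀ n, (0 : Unitization ℂ B) ≤ star ((a : Unitization ℂ B) * c n) * (a * c n) := fun n =>
    star_mul_self_nonneg _
  choose φ hφn hφ1 hφp using fun n => exists_state_apply_eq_norm (hp n)
  let ω : ℕ → (B →L[ℂ] ℂ) := fun n => LinearMap.mkContinuous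
    { toFun := fun b => φ n (c n * b * c n)
      map_add' := fun x y => by simp [mul_add, add_mul]
      map_smul' := fun r x => by simp } 4 (fun b => by
        have h1 := (φ n).le_of_opNorm_le (hφn n) (c n * b * c n)
        have h2 : ‖c n * (b : Unitization ℂ B) * c n‖ ≤ 2 * ‖b‖ * 2 := by
          refine (norm_mul_le _ _).trans ?_
          gcongr
          · refine (norm_mul_le _ _).trans ?_
            rw [Unitization.norm_inr]
            gcongr
            exact hcn n
          · exact hcn n
        refine h1.trans ?_
        linarith)
  have hω : ∀ n b, ω n b = φ n (c n * b * c n) := fun n b => rfl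
  have hωstar : ∀ n (b : B), ω n (star b * b) =
      φ n (star ((b : Unitization ℂ B) * c n) * (b * c n)) := by
    intro n b
    rw [hω, star_mul, (hcsa n).star_eq, Unitization.inr_mul, Unitization.inr_star]
    simp only [mul_assoc]
  have hωpos : ∀ n (b : B), 0 ≤ (ω n (star b * b)).re ∧ (ω n (star b * b)).im = 0 := by
    intro n b
    rw [hωstar]
    exact ⟨re_apply_nonneg_of_norm_le_one (hφn n) (hφ1 n) (star_mul_self_nonneg _),
      im_apply_eq_zero_of_norm_le_one (hφn n) (hφ1 n) (IsSelfAdjoint.star_mul_self _)⟩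
  have hωa : ∀ n, ε ^ 2 ≤ (ω n (star a * a)).re := by
    intro n
    have h1 : (a : Unitization ℂ B) * c n = ((a - a * cfcₙ (ramp n) h : B) : Unitization ℂ B) := by
      simp only [c, mul_sub, mul_one, Unitization.inr_sub, Unitization.inr_mul]
    rw [hωstar, hφp, Complex.ofReal_re, CStarRing.norm_star_mul_self, h1, Unitization.norm_inr, sq]
    have := hcon n
    gcongr
  have hωh : ∀ n, ‖ω n h‖ ≤ 2 / 2 ^ n * 2 := by
    intro n
    have h1 : c n * (h : Unitization ℂ B) = (cfcₙ (fun x => x * (1 - ramp n x)) h : B) := by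
      have h2 : cfcₙ (fun x => x * (1 - ramp n x)) h = h - cfcₙ (ramp n) h * h :=
        cfcₙ_mul_one_sub_ramp hsa n
      rw [h2]
      simp only [c, sub_mul, one_mul, Unitization.inr_sub, Unitization.inr_mul]
    have h3 : ‖cfcₙ (fun x => x * (1 - ramp n x)) h‖ ≤ 2 / 2 ^ n := norm_cfcₙ_le fun x hx =>
      abs_mul_one_sub_ramp_le n (quasispectrum_star_mul_self_nonneg b₀ (hb₀ ▸ hx))
    rw [hω, h1]
    have h4 := (φ n).le_of_opNorm_le (hφn n)
      ((cfcₙ (fun x => x * (1 - ramp n x)) h : B) * c n)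
    rw [one_mul] at h4
    refine h4.trans ((norm_mul_le _ _).trans ?_)
    rw [Unitization.norm_inr]
    have := hcn n
    gcongr
  have hωball : ∀ n, ‖ω n‖ ≤ 4 := fun n => LinearMap.mkContinuous_norm_le _ (by norm_num) _
  -- Banach–Alaoglu along an ultrafilter: the limit is positive, nonzero and vanishes at `h`,
  -- against strict positivity.
  obtain ⟨ω', -, hω'⟩ := (WeakDual.isCompact_closedBall (𝕜 := ℂ) (0 : B →L[ℂ] ℂ)
    4).ultrafilter_le_nhds ((hyperfilter ℕ).map fun n => StrongDual.toWeakDual (ω n)) (by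
      rw [le_principal_iff]
      refine Ultrafilter.mem_map.2 (univ_mem' fun n => ?_)
      simpa using hωball n)
  have hlim : ∀ b, Tendsto (fun n => ω n b) (hyperfilter ℕ) (𝓝 (ω' b)) := fun b =>
    ((WeakDual.eval_continuous b).tendsto ω').comp hω'
  let f : B →L[ℂ] ℂ := WeakDual.toStrongDual ω'
  have hre : ∀ b, Tendsto (fun n => (ω n b).re) (hyperfilter ℕ) (𝓝 (f b).re) := fun b =>
    (Complex.continuous_re.tendsto _).comp (hlim b)
  have him : ∀ b, Tendsto (fun n => (ω n b).im) (hyperfilter ℕ) (𝓝 (f b).im) := fun b =>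
    (Complex.continuous_im.tendsto _).comp (hlim b)
  have hf0 : f ≠ 0 := by
    intro h0
    have := ge_of_tendsto' (hre (star a * a)) hωa
    rw [h0] at this
    simp only [zero_apply, Complex.zero_re] at this
    have : 0 < ε ^ 2 := by positivity
    linarith
  have hfh : f h = 0 := by
    refine tendsto_nhds_unique (hlim h) (squeeze_zero_norm hωh ?_)
    have h1 : Tendsto (fun n : ℕ => 2 / (2 : ℝ) ^ n * 2) atTop (𝓝 0) := by
      have := (tendsto_pow_atTop_nhds_zero_of_lt_one (r := (2⁻¹ : ℝ)) (by norm_num)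
        (by norm_num)).const_mul 4
      rw [mul_zero] at this
      refine this.congr fun n => ?_
      rw [inv_pow]; ring
    exact h1.mono_left Nat.hyperfilter_le_atTop
  have := hstr f (fun b => ⟨ge_of_tendsto' (hre _) fun n => (hωpos n b).1,
    tendsto_nhds_unique (him _) (tendsto_const_nhds.congr fun n => (hωpos n b).2.symm)⟩) hf0
  rw [hfh] at this
  simp at this

end StrictlyPositive

/-! ### Bump functions with telescoping squares -/

section Bumps

theorem ramp_le_ramp {m n : ℕ} (hmn : m ≤ n) (x : ℝ) : ramp m x ≤ ramp n x := by
  rcases hmn.eq_or_lt with rfl | h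
  · exact le_rfl
  · by_cases h0 : ramp m x = 0
    · rw [h0]; exact ramp_nonneg n x
    · rw [ramp_eq_one_of_ne_zero h h0]; exact ramp_le_one m x

/-- Functions with square sum `1` on `(0, 1]` of which only neighbours overlap. -/
noncomputable def bump (n : ℕ) (x : ℝ) : ℝ := √(ramp (n + 1) x - ramp n x)

theorem continuous_bump (n : ℕ) : Continuous (bump n) :=
  ((continuous_ramp (n + 1)).sub (continuous_ramp n)).sqrt

theorem bump_zero_right (n : ℕ) : bump n 0 = 0 := by simp [bump, ramp_zero_right]

theorem bump_nonneg (n : ℕ) (x : ℝ) : 0 ≤ bump n x := Real.sqrt_nonneg _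

theorem bump_mul_self (n : ℕ) (x : ℝ) : bump n x * bump n x = ramp (n + 1) x - ramp n x :=
  Real.mul_self_sqrt (sub_nonneg.2 (ramp_le_ramp n.le_succ x))

theorem bump_le_one (n : ℕ) (x : ℝ) : bump n x ≤ 1 := by
  have h1 := bump_mul_self n x
  have h2 := ramp_nonneg n x
  have h3 := ramp_le_one (n + 1) x
  nlinarith [bump_nonneg n x]

theorem bump_eq_zero {m n : ℕ} (hmn : m < n) {x : ℝ} (h : ramp m x ≠ 0) : bump n x = 0 := by
  rw [bump, ramp_eq_one_of_ne_zero hmn h, ramp_eq_one_of_ne_zero (hmn.trans n.lt_succ_self) h,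
    sub_self, Real.sqrt_zero]

theorem bump_eq_zero_of_bump_ne_zero {m n : ℕ} (hmn : m + 1 < n) {x : ℝ} (h : bump m x ≠ 0) :
    bump n x = 0 := by
  refine bump_eq_zero hmn fun h0 => h ?_
  have : ramp m x = 0 := le_antisymm ((ramp_le_ramp m.le_succ x).trans_eq h0) (ramp_nonneg m x)
  rw [bump, h0, this, sub_zero, Real.sqrt_zero]

theorem bump_mul_bump_eq_zero {m n : ℕ} (h : m + 1 < n ∨ n + 1 < m) (x : ℝ) :
    bump m x * bump n x = 0 := by
  by_contra hne
  rcases h with h | h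
  · exact right_ne_zero_of_mul hne (bump_eq_zero_of_bump_ne_zero h (left_ne_zero_of_mul hne))
  · exact left_ne_zero_of_mul hne (bump_eq_zero_of_bump_ne_zero h (right_ne_zero_of_mul hne))

/-- At a given `x` only the first nonzero bump and its successor can contribute. -/
theorem sum_bump_le_two (s : Finset ℕ) (x : ℝ) : ∑ n ∈ s, bump n x ≤ 2 := by
  classical
  by_cases h : ∃ n, bump n x ≠ 0
  · set m := Nat.find h with hm
    have h0 : bump m x ≠ 0 := Nat.find_spec h
    have hz : ∀ n, n ∉ ({m, m + 1} : Finset ℕ) → bump n x = 0 := by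
      intro n hn
      simp only [Finset.mem_insert, Finset.mem_singleton, not_or] at hn
      by_contra hne
      have h1 : m ≤ n := Nat.find_min' h hne
      exact hne (bump_eq_zero_of_bump_ne_zero (by omega) h0)
    calc ∑ n ∈ s, bump n x ≤ ∑ n ∈ s ∪ {m, m + 1}, bump n x :=
          Finset.sum_le_sum_of_subset_of_nonneg Finset.subset_union_left
            fun n _ _ => bump_nonneg n x
      _ = ∑ n ∈ {m, m + 1}, bump n x :=
          (Finset.sum_subset Finset.subset_union_right fun n _ hn => hz n hn).symm
      _ = bump m x + bump (m + 1) x := by rw [Finset.sum_pair (by omega)]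
      _ ≤ 2 := by linarith [bump_le_one m x, bump_le_one (m + 1) x]
  · push Not at h
    simp [h]

theorem sum_range_bump_mul_self (N : ℕ) (x : ℝ) :
    ∑ n ∈ Finset.range N, bump n x * bump n x = ramp N x - ramp 0 x := by
  simp only [bump_mul_self]
  exact Finset.sum_range_sub (fun n => ramp n x) N

theorem sum_bump_mul_self_le_one (s : Finset ℕ) (x : ℝ) :
    ∑ n ∈ s, bump n x * bump n x ≤ 1 := by
  obtain ⟨N, hN⟩ := s.exists_nat_subset_range
  have := Finset.sum_le_sum_of_subset_of_nonneg hN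
    (f := fun n => bump n x * bump n x) fun n _ _ => mul_self_nonneg _
  refine this.trans ?_
  rw [sum_range_bump_mul_self]
  linarith [ramp_le_one N x, ramp_nonneg 0 x]

/-- Where `ramp N` is nonzero, the bumps beyond `N` vanish and the others telescope to `ramp (N + 1)
x - ramp 0 x = 1`; the bound on `x` removes `ramp 0`. -/
theorem ramp_mul_sum_bump {N : ℕ} {s : Finset ℕ} (hs : Finset.range (N + 1) ⊆ s) {x : ℝ}
    (hx : |x| ≤ 1) : ramp N x * ∑ n ∈ s, bump n x * bump n x = ramp N x := by
  by_cases h : ramp N x = 0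
  · rw [h, zero_mul]
  · have h0 : ramp 0 x = 0 := ramp_eq_zero (by simpa using (le_abs_self x).trans hx)
    rw [← Finset.sum_subset hs, sum_range_bump_mul_self, h0,
      ramp_eq_one_of_ne_zero N.lt_succ_self h, sub_zero, mul_one]
    intro n _ hn
    rw [bump_eq_zero (m := N) (by simpa using hn) h, zero_mul]

variable {B : Type v} [NonUnitalCStarAlgebra B]

theorem cfcₙ_bump_mul_self {k : B} (n : ℕ) :
    cfcₙ (bump n) k * cfcₙ (bump n) k = cfcₙ (fun x => bump n x * bump n x) k :=
  (cfcₙ_mul (bump n) (bump n) k (continuous_bump n).continuousOn (bump_zero_right n)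
    (continuous_bump n).continuousOn (bump_zero_right n)).symm

theorem cfcₙ_bump_mul_cfcₙ_bump {k : B} {m n : ℕ} (h : m + 1 < n ∨ n + 1 < m) :
    cfcₙ (bump m) k * cfcₙ (bump n) k = 0 := by
  rw [← cfcₙ_mul (bump m) (bump n) k (continuous_bump m).continuousOn (bump_zero_right m)
    (continuous_bump n).continuousOn (bump_zero_right n)]
  simp only [bump_mul_bump_eq_zero h, cfcₙ_const_zero]

theorem norm_signed_sum_cfcₙ_bump_le (k : B) (s : Finset ℕ) (ε : ℕ → ℤˣ) :
    ‖∑ n ∈ s, ((ε n : ℤ) : ℂ) • cfcₙ (bump n) k‖ ≤ 2 := by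
  have h1 : ∀ n, ((ε n : ℤ) : ℂ) • cfcₙ (bump n) k
      = cfcₙ (fun x => ((ε n : ℤ) : ℝ) * bump n x) k := by
    intro n
    rw [cfcₙ_const_mul _ _ _ (continuous_bump n).continuousOn (bump_zero_right n)]
    rw [← Complex.coe_smul]
    simp
  simp only [h1]
  have h2 := cfcₙ_sum (fun n x => ((ε n : ℤ) : ℝ) * bump n x) k s
    (fun n _ => (continuous_const.mul (continuous_bump n)).continuousOn)
    (fun n _ => by simp [bump_zero_right])
  rw [← h2]
  refine norm_cfcₙ_le fun x _ => ?_
  rw [Finset.sum_apply]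
  refine (norm_sum_le _ _).trans (le_trans (Finset.sum_le_sum fun n _ => ?_) (sum_bump_le_two s x))
  rw [norm_mul, Real.norm_of_nonneg (bump_nonneg n x)]
  rcases Int.units_eq_one_or (ε n) with h | h <;> simp [h]

theorem sum_cfcₙ_bump_mul_self {k : B} (s : Finset ℕ) :
    ∑ n ∈ s, cfcₙ (bump n) k * cfcₙ (bump n) k
      = cfcₙ (fun x => ∑ n ∈ s, bump n x * bump n x) k := by
  simp only [cfcₙ_bump_mul_self]
  have := cfcₙ_sum (fun n x => bump n x * bump n x) k s
    (fun n _ => ((continuous_bump n).mul (continuous_bump n)).continuousOn)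
    (fun n _ => by simp [bump_zero_right])
  rw [← this]
  congr 1
  ext x
  simp

/-- A crude bound, uniform in `s`, for the points where `b` is already small. -/
theorem norm_sub_mul_sum_bump_le (k b : B) (s : Finset ℕ) :
    ‖b - b * ∑ n ∈ s, cfcₙ (bump n) k * cfcₙ (bump n) k‖ ≤ 2 * ‖b‖ := by
  have h1 : ‖∑ n ∈ s, cfcₙ (bump n) k * cfcₙ (bump n) k‖ ≤ 1 := by
    rw [sum_cfcₙ_bump_mul_self]
    refine norm_cfcₙ_le fun x _ => ?_
    rw [Real.norm_of_nonneg (Finset.sum_nonneg fun n _ => mul_self_nonneg _)]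
    exact sum_bump_mul_self_le_one s x
  calc _ ≤ ‖b‖ + ‖b‖ * 1 := (norm_sub_le _ _).trans (by
        gcongr; exact (norm_mul_le _ _).trans (by gcongr))
    _ = 2 * ‖b‖ := by ring

/-- The sum of squares fixes `ramp N`, so `b` may be replaced by `b - b * ramp N (k)` before the
crude bound is applied. -/
theorem norm_sub_mul_sum_bump_le_of_subset {k : B} (hsa : IsSelfAdjoint k) (hk : ‖k‖ ≤ 1) (b : B)
    {N : ℕ} {s : Finset ℕ} (hs : Finset.range (N + 1) ⊆ s) :
    ‖b - b * ∑ n ∈ s, cfcₙ (bump n) k * cfcₙ (bump n) k‖ ≤ 2 * ‖b - b * cfcₙ (ramp N) k‖ := by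
  have h1 : cfcₙ (ramp N) k * ∑ n ∈ s, cfcₙ (bump n) k * cfcₙ (bump n) k = cfcₙ (ramp N) k := by
    have hc : Continuous fun x => ∑ n ∈ s, bump n x * bump n x :=
      continuous_finsetSum s fun n _ => (continuous_bump n).mul (continuous_bump n)
    rw [sum_cfcₙ_bump_mul_self, ← cfcₙ_mul (ramp N) (fun x => ∑ n ∈ s, bump n x * bump n x) k
      (continuous_ramp N).continuousOn (ramp_zero_right N) hc.continuousOn
      (by simp [bump_zero_right])]
    refine cfcₙ_congr fun x hx => ramp_mul_sum_bump hs ?_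
    have h3 := norm_apply_le_norm_cfcₙ (fun x : ℝ => x) k hx
    rw [cfcₙ_id' ℝ k] at h3
    exact h3.trans hk
  have h2 := norm_sub_mul_sum_bump_le k (b - b * cfcₙ (ramp N) k) s
  rwa [sub_mul, mul_assoc b, h1, sub_sub_sub_cancel_right] at h2

end Bumps

/-! ### Left projectivity over a paracompact base -/

section Transfer

theorem IsStrictlyPositiveElement.map_equiv {B B' : Type v} [NonUnitalCStarAlgebra B]
    [NonUnitalCStarAlgebra B'] (e : B ≃⋆ₐ[ℂ] B') {h : B} (hh : IsStrictlyPositiveElement h) :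
    IsStrictlyPositiveElement (e h) := by
  obtain ⟨⟨b, rfl⟩, hstr⟩ := hh
  refine ⟨⟨e b, by rw [map_mul, map_star]⟩, fun f hf hf0 => ?_⟩
  let e' : B →L[ℂ] B' := LinearMap.mkContinuous
    { toFun := e, map_add' := map_add e, map_smul' := map_smul e } 1
    (fun x => by
      rw [one_mul]
      exact (NonUnitalStarAlgHom.norm_map e e.injective x).le)
  have he' : ∀ x, e' x = e x := fun x => rfl
  refine hstr (f.comp e') (fun x => ?_) fun h0 => hf0 ?_
  · rw [ContinuousLinearMap.comp_apply, he', map_mul, map_star]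
    exact hf (e x)
  · ext y
    have := DFunLike.congr_fun h0 (e.symm y)
    rwa [ContinuousLinearMap.comp_apply, he', StarAlgEquiv.apply_symm_apply] at this

theorem exists_eq_star_mul_self_of_hasSum {B : Type*} [NonUnitalCStarAlgebra B] {q : ℕ → B} {h : B}
    (hh : HasSum (fun n => star (q n) * q n) h) : ∃ b, h = star b * b := by
  let _ := CStarAlgebra.spectralOrder B
  have := CStarAlgebra.spectralOrderedRing B
  exact CStarAlgebra.nonneg_iff_eq_star_mul_self.1 (hh.nonneg fun n => star_mul_self_nonneg _)

theorem exists_map_eq_cfcₙ {B ι : Type*} [NonUnitalCStarAlgebra B] {A : ι → Type*}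
    [∀ i, NonUnitalCStarAlgebra (A i)] (φ : ∀ i, B →⋆ₙₐ[ℂ] A i) (hφ : ∀ i, Continuous (φ i)) {h : B}
    (hh : IsSelfAdjoint h) {f : ℝ → ℝ} (hf : Continuous f) (hf0 : f 0 = 0) :
    ∃ u : B, ∀ i, φ i u = cfcₙ f (φ i h) :=
  ⟨cfcₙ f h, fun i => (φ i).map_cfcₙ f h hf.continuousOn hf0 (hφ i) hh (hh.map (φ i))⟩

end Transfer

namespace ContinuousField

variable {Ω : Type u} [TopologicalSpace Ω] {A : Ω → Type v} [∀ t, NonUnitalCStarAlgebra (A t)]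

/-- Evaluation of sections at a point. -/
def evalHom (U : ContinuousField Ω A) (t : Ω) : U.sectionAlgebra →⋆ₙₐ[ℂ] A t where
  toFun x := (x : lp A ∞) t
  map_smul' _ _ := rfl
  map_zero' := rfl
  map_add' _ _ := rfl
  map_mul' _ _ := rfl
  map_star' _ := rfl

theorem continuous_evalHom (U : ContinuousField Ω A) (t : Ω) : Continuous (U.evalHom t) :=
  AddMonoidHomClass.continuous_of_bound (U.evalHom t) 1 fun x => by
    rw [one_mul]; exact U.norm_apply_le x t

theorem norm_evalHom_le (U : ContinuousField Ω A) (t : Ω) (x : U.sectionAlgebra) :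
    ‖U.evalHom t x‖ ≤ ‖x‖ := U.norm_apply_le x t

theorem continuous_norm_evalHom (U : ContinuousField Ω A) (x : U.sectionAlgebra) :
    Continuous fun t => ‖U.evalHom t x‖ := U.continuous_norm _ x.2.1

theorem tendsto_norm_evalHom (U : ContinuousField Ω A) (x : U.sectionAlgebra) :
    Tendsto (fun t => ‖U.evalHom t x‖) (cocompact Ω) (𝓝 0) := x.2.2

theorem ext_evalHom {U : ContinuousField Ω A} {x y : U.sectionAlgebra}
    (h : ∀ t, U.evalHom t x = U.evalHom t y) : x = y :=
  Subtype.ext (lp.ext (funext h))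

theorem norm_le_of_evalHom {U : ContinuousField Ω A} {x : U.sectionAlgebra} {C : ℝ} (hC : 0 ≤ C)
    (h : ∀ t, ‖U.evalHom t x‖ ≤ C) : ‖x‖ ≤ C :=
  lp.norm_le_of_forall_le hC h

/-- Functional calculus of a self-adjoint section, fibre by fibre. -/
theorem exists_evalHom_eq_cfcₙ (U : ContinuousField Ω A) {h : U.sectionAlgebra}
    (hh : IsSelfAdjoint h) {f : ℝ → ℝ} (hf : Continuous f) (hf0 : f 0 = 0) :
    ∃ u : U.sectionAlgebra, ∀ t, U.evalHom t u = cfcₙ f (U.evalHom t h) :=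
  exists_map_eq_cfcₙ (B := U.sectionAlgebra) U.evalHom U.continuous_evalHom hh hf hf0

variable [T2Space Ω] [LocallyCompactSpace Ω]

/-- Near each point there is a positive section that is strictly positive on the fibres. -/
theorem exists_locally_strictlyPositive (U : ContinuousField Ω A) (hU : U.IsLocallyTrivial)
    (hpos : U.HasStrictlyPositiveElements) {W : Set Ω} (hW : IsOpen W) {t₀ : Ω} (ht₀ : t₀ ∈ W) :
    ∃ q : U.sectionAlgebra, (∀ t, t ∉ W → U.evalHom t q = 0) ∧
      ∀ᶠ t in 𝓝 t₀, IsStrictlyPositiveElement (U.evalHom t (star q * q)) := by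
  obtain ⟨V, hV, htV, B, _, ⟨e⟩⟩ := hU t₀
  obtain ⟨h, hh⟩ := hpos t₀
  have hh₀ := hh.map_equiv (e.φ ⟨t₀, htV⟩)
  -- The section `q` is a cut-off of the constant `b`. Where the cut-off is 1, `star q * q` is the
  -- given strictly positive element carried along the trivialisation.
  obtain ⟨⟨b, hb⟩, -⟩ := id hh₀
  obtain ⟨g, hg1, -, -, hx⟩ := U.exists_cutoff hV e (hV.inter hW) Set.inter_subset_left ⟨htV, ht₀⟩
  obtain ⟨q, hq, hq0⟩ := hx b
  refine ⟨q, fun t ht => hq0 t fun h => ht h.2, ?_⟩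
  filter_upwards [hg1, hV.mem_nhds htV] with t ht htV'
  have h1 : U.evalHom t q = (e.φ ⟨t, htV'⟩).symm b := by
    refine (hq ⟨t, htV'⟩).trans ?_
    simp [ht]
  rw [map_mul, map_star, h1, ← map_star, ← map_mul, ← hb]
  exact hh₀.map_equiv (e.φ ⟨t, htV'⟩).symm

/-- Over an open σ-compact set there is a section that is strictly positive on the fibres. -/
theorem exists_strictlyPositive_section (U : ContinuousField Ω A) (hU : U.IsLocallyTrivial)
    (hpos : U.HasStrictlyPositiveElements) {W : Set Ω} (hW : IsOpen W) (hσ : IsSigmaCompact W) :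
    ∃ h : U.sectionAlgebra, IsSelfAdjoint h ∧ ‖h‖ ≤ 1 ∧ (∀ t, t ∉ W → U.evalHom t h = 0) ∧
      ∀ t ∈ W, IsStrictlyPositiveElement (U.evalHom t h) := by
  choose q hq0 hq using fun t : W => U.exists_locally_strictlyPositive hU hpos hW t.2
  have := isSigmaCompact_iff_sigmaCompactSpace.1 hσ
  obtain ⟨s, hsc, hsu⟩ := countable_cover_nhds_of_sigmaCompact
    (fun t : W => (continuous_subtype_val.tendsto t).eventually (hq t))
  rcases s.eq_empty_or_nonempty with rfl | hne
  · refine ⟨0, IsSelfAdjoint.zero _, by simp, fun t _ => map_zero _, fun t ht => ?_⟩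
    have : (⟨t, ht⟩ : W) ∈ (Set.univ : Set W) := Set.mem_univ _
    rw [← hsu] at this
    simp at this
  obtain ⟨f, rfl⟩ := hsc.exists_eq_range hne
  rw [Set.biUnion_range] at hsu
  let p : ℕ → U.sectionAlgebra := fun n => star (q (f n)) * q (f n)
  -- Positive weights with `‖c n • p n‖ ≤ 2⁻ⁿ / 2`; these bounds add up to 1, whence `‖h‖ ≤ 1`.
  let c : ℕ → ℝ := fun n => (1 / 2) ^ n / 2 / (‖p n‖ + 1)
  have hc : ∀ n, 0 < c n := fun n => by positivity
  have hcp : ∀ n, ‖(c n : ℂ) • p n‖ ≤ (1 / 2) ^ n / 2 := by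
    intro n
    rw [norm_smul, Complex.norm_real, Real.norm_of_nonneg (hc n).le]
    calc c n * ‖p n‖ ≤ c n * (‖p n‖ + 1) := by have := hc n; gcongr; linarith
      _ = (1 / 2) ^ n / 2 := by simp only [c]; field_simp
  have hgeom : HasSum (fun n : ℕ => ((1 / 2 : ℝ) ^ n / 2)) 1 := by
    simpa using hasSum_geometric_two.div_const 2
  have hsum : Summable fun n => (c n : ℂ) • p n := .of_norm_bounded hgeom.summable hcp
  let h := ∑' n, (c n : ℂ) • p n
  have hh : HasSum (fun n => (c n : ℂ) • p n) h := hsum.hasSum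
  have heval : ∀ t, HasSum (fun n => (c n : ℂ) • U.evalHom t (p n)) (U.evalHom t h) := by
    intro t
    have h1 := hh.map (U.evalHom t) (U.continuous_evalHom t)
    have h2 : (U.evalHom t ∘ fun n => (c n : ℂ) • p n) = fun n => (c n : ℂ) • U.evalHom t (p n) :=
      funext fun n => map_smul (U.evalHom t) _ _
    rwa [h2] at h1
  have hb : ∃ b, h = star b * b := by
    have h1 : (fun n => (c n : ℂ) • p n) = fun n =>
        star (((√(c n) : ℝ) : ℂ) • q (f n)) * (((√(c n) : ℝ) : ℂ) • q (f n)) := by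
      funext n
      rw [star_smul, smul_mul_smul_comm, Complex.star_def, Complex.conj_ofReal,
        ← Complex.ofReal_mul, Real.mul_self_sqrt (hc n).le]
    exact exists_eq_star_mul_self_of_hasSum (h1 ▸ hh)
  obtain ⟨b, hb⟩ := hb
  refine ⟨h, hb ▸ IsSelfAdjoint.star_mul_self b, ?_, fun t ht => ?_, fun t ht => ?_⟩
  · exact tsum_of_norm_bounded hgeom hcp
  · refine (heval t).unique ?_
    have : ∀ n, (c n : ℂ) • U.evalHom t (p n) = 0 := fun n => by
      rw [map_mul, hq0 _ t ht, mul_zero, smul_zero]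
    simp only [this]
    exact hasSum_zero
  · refine ⟨⟨U.evalHom t b, by rw [hb, map_mul, map_star]⟩, fun φ hφ hφ0 => ?_⟩
    obtain ⟨n, hn⟩ := Set.mem_iUnion.1 (hsu.symm ▸ Set.mem_univ (⟨t, ht⟩ : W))
    have h1 : HasSum (fun n => c n * (φ (U.evalHom t (p n))).re) (φ (U.evalHom t h)).re := by
      have := Complex.hasSum_re ((heval t).mapL φ)
      simpa only [map_smul, smul_eq_mul, Complex.re_ofReal_mul] using this
    have hnn : ∀ m, 0 ≤ (φ (U.evalHom t (p m))).re := fun m => by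
      simp only [p, map_mul, map_star]
      exact (hφ _).1
    -- All terms are nonnegative, and the one whose section is strictly positive near `t` is
    -- positive.
    have h2 := le_hasSum h1 n fun m _ => mul_nonneg (hc m).le (hnn m)
    exact (mul_pos (hc n) (hn.2 φ hφ hφ0)).trans_le h2

end ContinuousField

/-- Over a point of `W μ` only the indices `(μ, n)` contribute, which reduces fibrewise sums to the
case of a single element. -/
theorem sum_eq_sum_slice {M E : Type*} [DecidableEq M] [AddCommMonoid E] (s : Finset (M × ℕ))
    (μ : M) (F : M × ℕ → E) (hF : ∀ i, i.1 ≠ μ → F i = 0) :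
    ∑ i ∈ s, F i = ∑ n ∈ (s.filter fun i => i.1 = μ).image Prod.snd, F (μ, n) := by
  have hinj : Set.InjOn Prod.snd ((s.filter fun i => i.1 = μ : Finset (M × ℕ)) : Set (M × ℕ)) := by
    rintro ⟨a, n⟩ ha ⟨b, m⟩ hb rfl
    simp only [Finset.coe_filter, Set.mem_ofPred_eq] at ha hb
    rw [ha.2, hb.2]
  rw [Finset.sum_image hinj]
  have : ∀ i ∈ s.filter fun i => i.1 = μ, F (μ, i.2) = F i := by
    rintro ⟨a, n⟩ ha
    rw [← (Finset.mem_filter.1 ha).2]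
  rw [Finset.sum_congr rfl this, Finset.sum_filter]
  exact Finset.sum_congr rfl fun i _ => by split_ifs with h <;> [rfl; exact hF i h]

namespace ContinuousField

variable {Ω : Type u} [TopologicalSpace Ω] {A : Ω → Type v} [∀ t, NonUnitalCStarAlgebra (A t)]
  [T2Space Ω] [LocallyCompactSpace Ω]

/-- The section algebra of a locally trivial field with strictly positive elements over a disjoint
union of open σ-compact sets is left projective. -/
theorem isLeftProjective_of_partition (U : ContinuousField Ω A) (hU : U.IsLocallyTrivial)
    (hpos : U.HasStrictlyPositiveElements) {M : Type*} {W : M → Set Ω}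
    (hW : IsSigmaCompactPartition W) : IsLeftProjective.{max u v, w} U.sectionAlgebra := by
  classical
  choose h hsa hn h0 hstr using fun μ =>
    U.exists_strictlyPositive_section hU hpos (hW.isOpen μ) (hW.isSigmaCompact μ)
  choose u hu using fun i : M × ℕ =>
    U.exists_evalHom_eq_cfcₙ (hsa i.1) (continuous_bump i.2) (bump_zero_right i.2)
  choose ρ hρ using fun i : M × ℕ =>
    U.exists_evalHom_eq_cfcₙ (hsa i.1) (continuous_ramp i.2) (ramp_zero_right i.2)
  have hmem : ∀ t, ∃ μ, t ∈ W μ := fun t => Set.mem_iUnion.1 (hW.iUnion_eq ▸ Set.mem_univ t)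
  have hu0 : ∀ {t μ}, t ∈ W μ → ∀ i : M × ℕ, i.1 ≠ μ → U.evalHom t (u i) = 0 := by
    intro t μ ht i hi
    rw [hu, h0 i.1 t fun ht' => Set.disjoint_left.1 (hW.disjoint hi) ht' ht, cfcₙ_apply_zero]
  have hsum : ∀ {t μ}, t ∈ W μ → ∀ (b : U.sectionAlgebra) (s : Finset (M × ℕ)),
      U.evalHom t (b - ∑ i ∈ s, b * u i * u i) = U.evalHom t b - U.evalHom t b *
        ∑ n ∈ (s.filter fun i => i.1 = μ).image Prod.snd,
          cfcₙ (bump n) (U.evalHom t (h μ)) * cfcₙ (bump n) (U.evalHom t (h μ)) := by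
    intro t μ ht b s
    rw [map_sub, map_sum, sum_eq_sum_slice s μ _ fun i hi => by rw [map_mul, hu0 ht i hi, mul_zero],
      Finset.mul_sum]
    refine congrArg _ (Finset.sum_congr rfl fun n _ => ?_)
    rw [map_mul, map_mul, hu, mul_assoc]
  refine isLeftProjective_of_family u 2 (fun s ε => norm_le_of_evalHom zero_le_two fun t => ?_)
    (fun i => ?_) (fun b => ?_)
  · obtain ⟨μ, ht⟩ := hmem t
    rw [map_sum, sum_eq_sum_slice s μ _ fun i hi => by rw [map_smul, hu0 ht i hi, smul_zero]]
    simp only [map_smul, hu]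
    exact norm_signed_sum_cfcₙ_bump_le _ _ fun n => ε (μ, n)
  · refine ((Set.finite_Icc (i.2 - 1) (i.2 + 1)).image fun n => (i.1, n)).subset ?_
    rintro ⟨ν, m⟩ hne
    by_contra hnot
    refine hne (ext_evalHom fun t => ?_)
    rw [map_mul, map_zero]
    by_cases hν : i.1 = ν
    · subst hν
      rw [hu, hu]
      refine cfcₙ_bump_mul_cfcₙ_bump ?_
      by_contra hcon
      exact hnot ⟨m, ⟨by omega, by omega⟩, rfl⟩
    · obtain ⟨μ, ht⟩ := hmem t
      by_cases hμ : i.1 = μ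
      · rw [hu0 ht (ν, m) fun hh => hν (hμ.trans hh.symm), mul_zero]
      · rw [hu0 ht i hμ, zero_mul]
  · rw [HasSum, SummationFilter.unconditional_filter, Metric.tendsto_nhds]
    intro ε hε
    -- Outside `K` the crude factor 2 suffices. On `K`, finitely many neighbourhoods with their
    -- indices `N t` determine which finite sets of indices are large enough.
    obtain ⟨K, hK, hKb⟩ := mem_cocompact.1
      ((U.tendsto_norm_evalHom b).eventually_lt_const (u := ε / 4) (by positivity))
    choose μ hμ using hmem
    choose N hN using fun t =>
      (hstr (μ t) t (hμ t)).exists_norm_sub_mul_cfcₙ_ramp_lt (U.evalHom t b)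
        (ε := ε / 4) (by positivity)
    -- Expressing the defect through the global section `ρ` makes its norm continuous in `r`, so the
    -- estimate at `t` extends to a neighbourhood.
    have heval : ∀ t r, U.evalHom r (b - b * ρ (μ t, N t)) = U.evalHom r b - U.evalHom r b *
        cfcₙ (ramp (N t)) (U.evalHom r (h (μ t))) := fun t r => by
      rw [map_sub, map_mul, hρ]
    have hnhds : ∀ t ∈ K, W (μ t) ∩ {r | ‖U.evalHom r (b - b * ρ (μ t, N t))‖ < ε / 4} ∈ 𝓝 t := by
      intro t _
      refine inter_mem ((hW.isOpen _).mem_nhds (hμ t)) ?_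
      refine (isOpen_lt (U.continuous_norm_evalHom _) continuous_const).mem_nhds ?_
      change ‖U.evalHom t (b - b * ρ (μ t, N t))‖ < ε / 4
      rw [heval]
      exact hN t
    obtain ⟨T, -, hKT⟩ := hK.elim_nhds_subcover _ hnhds
    filter_upwards [eventually_ge_atTop
      (T.biUnion fun t => (Finset.range (N t + 1)).image fun n => (μ t, n))] with s hs
    rw [dist_comm, dist_eq_norm]
    refine lt_of_le_of_lt (norm_le_of_evalHom (C := 2 * (ε / 4)) (by positivity) fun r => ?_)
      (by linarith)
    by_cases hr : r ∈ K
    · obtain ⟨t, ht, hrt, hrb⟩ := Set.mem_iUnion₂.1 (hKT hr)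
      rw [hsum hrt]
      refine (norm_sub_mul_sum_bump_le_of_subset ((hsa (μ t)).map (U.evalHom r))
        ((U.norm_evalHom_le r _).trans (hn _)) _ (N := N t) ?_).trans ?_
      · intro n hn'
        refine Finset.mem_image.2 ⟨(μ t, n), Finset.mem_filter.2 ⟨hs ?_, rfl⟩, rfl⟩
        exact Finset.mem_biUnion.2 ⟨t, ht, Finset.mem_image_of_mem _ hn'⟩
      · rw [← heval]
        have : ‖U.evalHom r (b - b * ρ (μ t, N t))‖ < ε / 4 := hrb
        linarith
    · rw [hsum (hμ r)]
      refine (norm_sub_mul_sum_bump_le _ _ _).trans ?_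
      have : ‖U.evalHom r b‖ < ε / 4 := hKb hr
      linarith

end ContinuousField

/-! ### The equivalence and the vanishing of second cohomology -/

theorem theorem6p16 {Ω : Type u} [TopologicalSpace Ω] [LocallyCompactSpace Ω] [T2Space Ω]
    (ℓ : ℕ) (hdim : TopologicalDimLE Ω ℓ)
    {A : Ω → Type v} [∀ t, NonUnitalCStarAlgebra (A t)] [∀ t, Nontrivial (A t)]
    (U : ContinuousField Ω A) (hU : U.IsLocallyTrivial)
    (hpos : U.HasStrictlyPositiveElements) :
    (ParacompactSpace Ω ↔
      IsLeftProjective.{max u v, w} U.sectionAlgebra ∧ U.IsDisjointUnionOfSigmaLocallyTrivial) ∧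
    (ParacompactSpace Ω ∨
        (IsLeftProjective.{max u v, w} U.sectionAlgebra ∧
          U.IsDisjointUnionOfSigmaLocallyTrivial) →
      ∀ (X : Type (max u v w)) [NormedAddCommGroup X] [NormedSpace ℂ X] [CompleteSpace X]
        (m : BanachBimodule U.sectionAlgebra X), m.IsRightAnnihilator →
        Subsingleton (m.Cohomology 2)) := by
  have key : ParacompactSpace Ω →
      IsLeftProjective.{max u v, w} U.sectionAlgebra ∧
        U.IsDisjointUnionOfSigmaLocallyTrivial := by
    intro _
    obtain ⟨M, W, hW⟩ := exists_isSigmaCompactPartition_of_paracompact Ω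
    exact ⟨U.isLeftProjective_of_partition hU hpos hW,
      U.isDisjointUnionOfSigmaLocallyTrivial hU hpos hW⟩
  refine ⟨⟨key, fun h => U.paracompactSpace_of_isLeftProjective h.1 h.2⟩, ?_⟩
  intro h X _ _ _ m hm
  have hP : IsLeftProjective.{max u v, w} U.sectionAlgebra := h.elim (fun h => (key h).1) And.left
  have : CompleteSpace U.sectionAlgebra := U.isClosed_sectionAlgebra.completeSpace_coe
  exact hP.subsingleton_cohomology_two X m hm
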